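/- There are a deterministic random access machine program and absolute constants $c,k$ such that the following holds. Let $G$ be a finite simple undirected graph with $n$ vertices, let $A \subseteq V(G)$, and let $C \subseteq V(G)$ with $|C| \ge 3$ be a set that separates $A$ from $V(G)\setminus A$, i.e. there is no path from $A \setminus C$ to $(V(G)\setminus A)\setminus C$ in $G[V(G)\setminus C]$. Let $S$ be a finite family of distinct subsets of $E(G[A \cup C])$, where $G[W]$ denotes the subgraph of $G$ induced by $W$. Given $G$, $A$, $C$ and $S$, the program computes, in time at most $c\, n^{k} \cdot \max(|S|,1) \cdot 12^{|C|}$, a subfamily $\hat S \subseteq S$ with $|\hat S| \le 6^{|C|}$ such that for every set $Y \subseteq E(G[C \cup (V(G) \setminus A)])$: if some $X \in S$ is disjoint from $Y$ and $X \cup Y$ is the edge set of a Hamiltonian cycle of $G$, then some $\hat X \in \hat S$ is disjoint from $Y$ and $\hat X \cup Y$ is the edge set of a Hamiltonian cycle of $G$. (The vertices are numbered $0,\dots,n-1$, sets and graphs are given by $0$-$1$ tables, and time is measured by logarithmic cost: each operation is charged one plus the binary lengths of the numbers and addresses involved.) -/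

import Mathlib

/-! ### A random access machine with logarithmic cost

Programs are built from assignments, array writes, sequencing, branching and loops, over natural
number variables and unbounded natural number arrays, all addressed by number.  Every operation is
charged one plus the binary lengths of the numbers that it touches, addresses included. -/

namespace RAM

/-- A memory configuration: variable `x` holds `var x`, cell `i` of array `a` holds `arr a i`. -/
structure State where
  var : ℕ → ℕ
  arr : ℕ → ℕ → ℕ

/-- Write `v` to variable `x`. -/
def State.setVar (σ : State) (x v : ℕ) : State :=
  { σ with var := Function.update σ.var x v }

/-- Write `v` to cell `i` of array `a`. -/
def State.setArr (σ : State) (a i v : ℕ) : State :=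
  { σ with arr := Function.update σ.arr a (Function.update (σ.arr a) i v) }

/-- Expressions; `load a e` reads the cell of array `a` whose index is the value of `e`. -/
inductive Expr where
  | const (k : ℕ)
  | var (x : ℕ)
  | load (a : ℕ) (e : Expr)
  | add (e f : Expr)
  | sub (e f : Expr)

/-- The value of an expression; subtraction is truncated at `0`. -/
def Expr.eval (σ : State) : Expr → ℕ
  | .const k => k
  | .var x => σ.var x
  | .load a e => σ.arr a (e.eval σ)
  | .add e f => e.eval σ + f.eval σ
  | .sub e f => e.eval σ - f.eval σ

/-- The cost of evaluating an expression: one plus the binary length of the result, for every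
subexpression.  As `Nat.size (e.eval σ) < e.cost σ`, this charges for operands and addresses. -/
def Expr.cost (σ : State) : Expr → ℕ
  | .const k => 1 + k.size
  | .var x => 1 + (σ.var x).size
  | .load a e => e.cost σ + (1 + (σ.arr a (e.eval σ)).size)
  | .add e f => e.cost σ + f.cost σ + (1 + (e.eval σ + f.eval σ).size)
  | .sub e f => e.cost σ + f.cost σ + (1 + (e.eval σ - f.eval σ).size)

/-- Programs; a test succeeds when its expression is nonzero. -/
inductive Prog where
  | skip
  | assign (x : ℕ) (e : Expr)
  | store (a : ℕ) (e f : Expr)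
  | seq (p q : Prog)
  | cond (e : Expr) (p q : Prog)
  | loop (e : Expr) (p : Prog)

/-- `Runs p σ σ' t`: started in `σ`, the program `p` halts in `σ'` after a computation of total
cost `t`. -/
inductive Runs : Prog → State → State → ℕ → Prop
  | skip (σ : State) : Runs .skip σ σ 1
  | assign (σ : State) (x : ℕ) (e : Expr) :
      Runs (.assign x e) σ (σ.setVar x (e.eval σ)) (e.cost σ + 1)
  | store (σ : State) (a : ℕ) (e f : Expr) :
      Runs (.store a e f) σ (σ.setArr a (e.eval σ) (f.eval σ)) (e.cost σ + f.cost σ + 1)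
  | seq {p q : Prog} {σ σ' σ'' : State} {s t : ℕ} :
      Runs p σ σ' s → Runs q σ' σ'' t → Runs (.seq p q) σ σ'' (s + t)
  | cond_true {e : Expr} {p q : Prog} {σ σ' : State} {t : ℕ} :
      e.eval σ ≠ 0 → Runs p σ σ' t → Runs (.cond e p q) σ σ' (e.cost σ + 1 + t)
  | cond_false {e : Expr} {p q : Prog} {σ σ' : State} {t : ℕ} :
      e.eval σ = 0 → Runs q σ σ' t → Runs (.cond e p q) σ σ' (e.cost σ + 1 + t)
  | loop_true {e : Expr} {p : Prog} {σ σ' σ'' : State} {s t : ℕ} :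
      e.eval σ ≠ 0 → Runs p σ σ' s → Runs (.loop e p) σ' σ'' t →
        Runs (.loop e p) σ σ'' (e.cost σ + 1 + s + t)
  | loop_false {e : Expr} {p : Prog} {σ : State} :
      e.eval σ = 0 → Runs (.loop e p) σ σ (e.cost σ + 1)

end RAM

/-! ### Graphs -/

/-- `E(G[W])`: the edges of `G` with both ends in `W`. -/
def inducedEdges {V : Type*} (G : SimpleGraph V) (W : Set V) : Set (Sym2 V) :=
  {e | e ∈ G.edgeSet ∧ ∀ v ∈ e, v ∈ W}

/-- `C` separates `A` and `B`: there is no path from `A \ C` to `B \ C` in `G[V \ C]`. -/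
def Separates {V : Type*} (G : SimpleGraph V) (C A B : Set V) : Prop :=
  ∀ (a b : V) (ha : a ∈ A \ C) (hb : b ∈ B \ C),
    ¬ (G.induce Cᶜ).Reachable ⟨a, ha.2⟩ ⟨b, hb.2⟩

/-- The edge set `F` is (the edge set of) a Hamiltonian cycle of `G`. -/
def IsHamiltonianEdgeSet {V : Type*} [DecidableEq V] (G : SimpleGraph V)
    (F : Finset (Sym2 V)) : Prop :=
  ∃ (v : V) (p : G.Walk v v), p.IsHamiltonianCycle ∧ p.edges.toFinset = F

/-! ### Encoding of instances

Matrices over the vertex set `{0, …, n - 1}` are stored row by row.  A list of edge sets is stored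
as the sequence of the `0`-`1` adjacency matrices of its members. -/

open Classical in
/-- The `0`-`1` array that stores the list `L` of edge sets, padded with zeros. -/
noncomputable def encodeFamily {n : ℕ} (L : List (Finset (Sym2 (Fin n)))) (j : ℕ) : ℕ :=
  if ∃ (i : Fin L.length) (u v : Fin n),
    j = i * n ^ 2 + u * n + v ∧ s(u, v) ∈ L.get i then 1 else 0

open Classical in
/-- The initial memory for `G`, `A`, `C` and the list `L`: variable `0` holds `n`, variable `1` the
length of `L`, array `0` the adjacency matrix of `G`, arrays `1` and `2` the indicators of `A` and
`C`, array `3` the list `L`; everything else is zero. -/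
noncomputable def inputState {n : ℕ} (G : SimpleGraph (Fin n)) (A C : Finset (Fin n))
    (L : List (Finset (Sym2 (Fin n)))) : RAM.State where
  var
    | 0 => n
    | 1 => L.length
    | _ => 0
  arr
    | 0 => fun j => if ∃ u v : Fin n, j = u * n + v ∧ G.Adj u v then 1 else 0
    | 1 => fun j => if ∃ v ∈ A, j = (v : ℕ) then 1 else 0
    | 2 => fun j => if ∃ v ∈ C, j = (v : ℕ) then 1 else 0
    | 3 => encodeFamily L
    | _ => fun _ => 0

/-- The memory `σ` holds the list `L` as output: its length in variable `2`, its members in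
array `4`, whose cells beyond the encoding of `L` are irrelevant. -/
def OutputIs {n : ℕ} (σ : RAM.State) (L : List (Finset (Sym2 (Fin n)))) : Prop :=
  σ.var 2 = L.length ∧ ∀ j < L.length * n ^ 2, σ.arr 4 j = encodeFamily L j

/-! Call a colouring of the vertices by `ZMod 2` compatible with an edge set if it is constant along
its edges; an edge set connects all vertices exactly when only constant colourings are compatible
with it. On at least three vertices, X and Y are disjoint with Hamiltonian union iff their degrees
add up to 2 everywhere and only constant colourings are compatible with both (`hamiltonian_iff`).

Fix v₀ in C. The colourings compatible with X and Y that vanish at v₀ form a vector space over `ZMod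
2`, so their number is odd iff only constants are compatible (`card_colourings_ne_zero_iff`). If X
ties every vertex of A \ C to C, as it must inside a Hamiltonian cycle (`exists_mem_separator`),
then a colouring compatible with X is determined on A \ C by its restriction to C. Sorting by this
restriction turns the number modulo 2 into a scalar product of a vector that depends on X but not on
Y, the cut vector, indexed by the 2^|C| colourings of C, and a vector that depends on Y but not on X
(`card_colourings_eq_sum`). So if the cut vector of X lies in the span of cut vectors of valid sets
with the same degrees on C, one of these has a nonzero product with the vector of Y and can replace
X (`Represents.exists_hamiltonian`).

The program discards invalid sets, groups the others by their degrees on C, and keeps a set when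
Gaussian elimination against the rows of its group leaves a remainder (`reduce_spec`). Each kept set
takes a pivot cell of its own, given by one of 3^|C| degree sequences and one of 2^|C| coordinates;
hence the bound 6^|C|. Up to a polynomial factor, one elimination takes 4^|C| operations, well
within 12^|C|. All numbers have O(n²) bits, so logarithmic cost contributes a factor n². The triples
`Tri` count operations under a common bound B for all stored values. -/

/-! ### A program logic with step counts -/

namespace RAM

/-- The number of nodes of an expression, constants being counted in unary. -/
def Expr.nodes : Expr → ℕ
  | .const k => k + 1
  | .var _ => 1
  | .load _ e => e.nodes + 1
  | .add e f => e.nodes + f.nodes + 1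
  | .sub e f => e.nodes + f.nodes + 1

/-- All values in the memory are at most `B`. -/
def Bdd (B : ℕ) (σ : State) : Prop :=
  (∀ x, σ.var x ≤ B) ∧ ∀ a i, σ.arr a i ≤ B

/-- Only addition makes values grow, and it adds the bounds of its operands; counting constants in
unary absorbs them into the number of nodes. -/
theorem Expr.eval_le {B : ℕ} {σ : State} (h : Bdd B σ) (e : Expr) :
    e.eval σ ≤ e.nodes * (B + 1) := by
  induction e with
  | const k => simp only [Expr.eval, Expr.nodes]; nlinarith
  | var x => have := h.1 x; simp only [Expr.eval, Expr.nodes]; omega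
  | load a e _ =>
    have := h.2 a (e.eval σ); simp only [Expr.eval, Expr.nodes]; nlinarith
  | add e f he hf => simp only [Expr.eval, Expr.nodes]; nlinarith
  | sub e f he hf =>
    simp only [Expr.eval, Expr.nodes]
    have : e.eval σ - f.eval σ ≤ e.eval σ := Nat.sub_le _ _
    nlinarith

theorem Expr.cost_le {B M : ℕ} {σ : State} (h : Bdd B σ) (e : Expr)
    (hM : (e.nodes * (B + 1)).size ≤ M) : e.cost σ ≤ e.nodes * (1 + M) := by
  have key : ∀ e : Expr, (e.nodes * (B + 1)).size ≤ M → (e.eval σ).size ≤ M := fun e he =>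
    (Nat.size_le_size (e.eval_le h)).trans he
  induction e with
  | const k => have := key _ hM; simp only [Expr.eval, Expr.cost, Expr.nodes] at *; nlinarith
  | var x => have := key _ hM; simp only [Expr.eval, Expr.cost, Expr.nodes] at *; nlinarith
  | load a e ih =>
    have h1 := key _ hM
    have h2 := ih (le_trans (Nat.size_le_size (Nat.mul_le_mul_right _ (by simp [Expr.nodes]))) hM)
    simp only [Expr.eval, Expr.cost, Expr.nodes] at *; nlinarith
  | add e f he hf =>
    have h1 := key _ hM
    have h2 := he (le_trans (Nat.size_le_size (Nat.mul_le_mul_right _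
      (by simp only [Expr.nodes]; omega))) hM)
    have h3 := hf (le_trans (Nat.size_le_size (Nat.mul_le_mul_right _
      (by simp only [Expr.nodes]; omega))) hM)
    simp only [Expr.eval, Expr.cost, Expr.nodes] at *; nlinarith
  | sub e f he hf =>
    have h1 := key _ hM
    have h2 := he (le_trans (Nat.size_le_size (Nat.mul_le_mul_right _
      (by simp only [Expr.nodes]; omega))) hM)
    have h3 := hf (le_trans (Nat.size_le_size (Nat.mul_le_mul_right _
      (by simp only [Expr.nodes]; omega))) hM)
    simp only [Expr.eval, Expr.cost, Expr.nodes] at *; nlinarith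

/-- An upper bound for the cost of one elementary operation on values that are at most `B`. -/
def unitCost (B : ℕ) : ℕ := 49 * (1 + (24 * (B + 1)).size)

/-- No expression of the program has more than 24 nodes. A store evaluates two expressions and pays
one more, whence the 49 in `unitCost`. -/
theorem Expr.cost_le_unit {B : ℕ} {σ : State} (h : Bdd B σ) (e : Expr) (he : e.nodes ≤ 24) :
    e.cost σ ≤ 24 * (1 + (24 * (B + 1)).size) :=
  (e.cost_le h (Nat.size_le_size (Nat.mul_le_mul_right _ he))).trans (Nat.mul_le_mul_right _ he)

theorem unitCost_le_of_le_pow {B b : ℕ} (h : B ≤ 2 ^ b) : unitCost B ≤ 49 * (b + 7) := by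
  have : (24 * (B + 1)).size ≤ b + 6 := by
    rw [Nat.size_le]
    have : 1 ≤ 2 ^ b := Nat.one_le_two_pow
    rw [pow_add]; omega
  unfold unitCost; omega

/-! ### Frame conditions -/

/-- The variables that a program may write. -/
def Prog.wv : Prog → List ℕ
  | .skip => []
  | .assign x _ => [x]
  | .store _ _ _ => []
  | .seq p q => p.wv ++ q.wv
  | .cond _ p q => p.wv ++ q.wv
  | .loop _ p => p.wv

/-- The arrays that a program may write. -/
def Prog.wa : Prog → List ℕ
  | .skip => []
  | .assign _ _ => []
  | .store a _ _ => [a]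
  | .seq p q => p.wa ++ q.wa
  | .cond _ p q => p.wa ++ q.wa
  | .loop _ p => p.wa

/-- The memories `σ` and `τ` agree outside the variables `X` and the arrays `Y`. -/
def Frame (X Y : List ℕ) (σ τ : State) : Prop :=
  (∀ x, x ∉ X → τ.var x = σ.var x) ∧ ∀ a, a ∉ Y → τ.arr a = σ.arr a

theorem Frame.refl (X Y : List ℕ) (σ : State) : Frame X Y σ σ := ⟨fun _ _ => rfl, fun _ _ => rfl⟩

theorem Frame.trans {X Y : List ℕ} {σ τ υ : State} (h : Frame X Y σ τ) (h' : Frame X Y τ υ) :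
    Frame X Y σ υ :=
  ⟨fun x hx => (h'.1 x hx).trans (h.1 x hx), fun a ha => (h'.2 a ha).trans (h.2 a ha)⟩

theorem Frame.mono {X Y X' Y' : List ℕ} {σ τ : State} (h : Frame X Y σ τ) (hX : X ⊆ X')
    (hY : Y ⊆ Y') : Frame X' Y' σ τ :=
  ⟨fun x hx => h.1 x fun hh => hx (hX hh), fun a ha => h.2 a fun hh => ha (hY hh)⟩

@[simp] theorem State.var_setVar (σ : State) (x v y : ℕ) :
    (σ.setVar x v).var y = if y = x then v else σ.var y := by
  simp [State.setVar, Function.update_apply]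

@[simp] theorem State.arr_setVar (σ : State) (x v : ℕ) : (σ.setVar x v).arr = σ.arr := rfl

@[simp] theorem State.var_setArr (σ : State) (a i v : ℕ) : (σ.setArr a i v).var = σ.var := rfl

@[simp] theorem State.arr_setArr (σ : State) (a i v b : ℕ) :
    (σ.setArr a i v).arr b = if b = a then Function.update (σ.arr a) i v else σ.arr b := by
  simp only [State.setArr, Function.update_apply]

/-- The frame is read off the syntax, so for concrete programs `decide` settles which parts of the
memory survive, and specifications need not mention them. -/
theorem Runs.frame {p : Prog} {σ τ : State} {t : ℕ} (h : Runs p σ τ t) :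
    Frame p.wv p.wa σ τ := by
  induction h with
  | skip σ => exact Frame.refl _ _ _
  | assign σ x e =>
    refine ⟨fun y hy => ?_, fun a _ => rfl⟩
    simp only [Prog.wv, List.mem_singleton] at hy
    simp [hy]
  | store σ a e f =>
    refine ⟨fun y hy => rfl, fun b hb => ?_⟩
    simp only [Prog.wa, List.mem_singleton] at hb
    simp [hb]
  | seq _ _ h1 h2 =>
    exact (h1.mono (List.subset_append_left _ _) (List.subset_append_left _ _)).trans
      (h2.mono (List.subset_append_right _ _) (List.subset_append_right _ _))
  | cond_true _ _ h1 =>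
    exact h1.mono (List.subset_append_left _ _) (List.subset_append_left _ _)
  | cond_false _ _ h1 =>
    exact h1.mono (List.subset_append_right _ _) (List.subset_append_right _ _)
  | loop_true _ _ _ h1 h2 => exact h1.trans h2
  | loop_false _ => exact Frame.refl _ _ _

theorem Bdd.setVar {B : ℕ} {σ : State} (h : Bdd B σ) (x : ℕ) {v : ℕ} (hv : v ≤ B) :
    Bdd B (σ.setVar x v) := by
  refine ⟨fun y => ?_, h.2⟩
  rw [State.var_setVar]
  split_ifs
  exacts [hv, h.1 y]

theorem Bdd.setArr {B : ℕ} {σ : State} (h : Bdd B σ) (a i : ℕ) {v : ℕ} (hv : v ≤ B) :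
    Bdd B (σ.setArr a i v) := by
  refine ⟨h.1, fun b j => ?_⟩
  rw [State.arr_setArr]
  split_ifs
  · rw [Function.update_apply]
    split_ifs
    exacts [hv, h.2 a j]
  · exact h.2 b j

/-! ### Triples with operation counts -/

/-- Started in `σ` with all values at most `B`, the program `p` halts after at most `T` elementary
operations, keeps all values at most `B`, and ends in a memory that satisfies `Q`. -/
def Tri (B : ℕ) (p : Prog) (σ : State) (T : ℕ) (Q : State → Prop) : Prop :=
  Bdd B σ → ∃ τ t, Runs p σ τ t ∧ t ≤ T * unitCost B ∧ Bdd B τ ∧ Q τ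

namespace Tri

variable {B : ℕ} {p q : Prog} {σ : State} {T T' : ℕ} {Q Q' : State → Prop}

/-- Boundedness is a premise of `Tri`; having it at hand bounds values that are merely copied from
memory. -/
theorem of_bdd (h : Bdd B σ → Tri B p σ T Q) : Tri B p σ T Q := fun hB => h hB hB

theorem le (h : Tri B p σ T Q) (hT : T ≤ T') : Tri B p σ T' Q := fun hB =>
  let ⟨τ, t, h1, h2, h3⟩ := h hB
  ⟨τ, t, h1, h2.trans (Nat.mul_le_mul_right _ hT), h3⟩

theorem framed (h : Tri B p σ T Q) (hQ : ∀ τ, Frame p.wv p.wa σ τ → Q τ → Q' τ) :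
    Tri B p σ T Q' := fun hB =>
  let ⟨τ, t, h1, h2, h3, h4⟩ := h hB
  ⟨τ, t, h1, h2, h3, hQ τ h1.frame h4⟩

theorem skip (h : Q σ) : Tri B .skip σ 1 Q := fun hB =>
  ⟨σ, 1, Runs.skip σ, by unfold unitCost; omega, hB, h⟩

theorem assign {x : ℕ} {e : Expr} (he : e.nodes ≤ 24) (hv : e.eval σ ≤ B)
    (h : Q (σ.setVar x (e.eval σ))) : Tri B (.assign x e) σ 1 Q := fun hB =>
  ⟨_, _, Runs.assign σ x e, by have := e.cost_le_unit hB he; unfold unitCost; omega,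
    hB.setVar x hv, h⟩

theorem store {a : ℕ} {e f : Expr} (he : e.nodes ≤ 24) (hf : f.nodes ≤ 24) (hv : f.eval σ ≤ B)
    (h : Q (σ.setArr a (e.eval σ) (f.eval σ))) : Tri B (.store a e f) σ 1 Q := fun hB =>
  ⟨_, _, Runs.store σ a e f, by
    have := e.cost_le_unit hB he
    have := f.cost_le_unit hB hf
    unfold unitCost; omega, hB.setArr a _ hv, h⟩

theorem seq (h : Tri B p σ T fun τ => Tri B q τ T' Q) : Tri B (.seq p q) σ (T + T') Q :=
  fun hB =>
  let ⟨_, _, h1, h2, h3, h4⟩ := h hB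
  let ⟨υ, _, h1', h2', h3', h4'⟩ := h4 h3
  ⟨υ, _, h1.seq h1', by rw [add_mul]; exact add_le_add h2 h2', h3', h4'⟩

theorem cond {e : Expr} (he : e.nodes ≤ 24) (h : e.eval σ ≠ 0 → Tri B p σ T Q)
    (h' : e.eval σ = 0 → Tri B q σ T' Q) : Tri B (.cond e p q) σ (T + T' + 1) Q := fun hB => by
  have hc := e.cost_le_unit hB he
  by_cases h0 : e.eval σ = 0
  · obtain ⟨τ, t, h1, h2, h3⟩ := h' h0 hB
    refine ⟨τ, _, Runs.cond_false h0 h1, ?_, h3⟩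
    rw [add_mul, add_mul, one_mul]
    have : e.cost σ + 1 ≤ unitCost B := by unfold unitCost; omega
    have := Nat.zero_le (T * unitCost B)
    omega
  · obtain ⟨τ, t, h1, h2, h3⟩ := h h0 hB
    refine ⟨τ, _, Runs.cond_true h0 h1, ?_, h3⟩
    rw [add_mul, add_mul, one_mul]
    have : e.cost σ + 1 ≤ unitCost B := by unfold unitCost; omega
    have := Nat.zero_le (T' * unitCost B)
    omega

end Tri

/-- `for x = 0, …, y - 1 do p`, with variables `x` and `y`. -/
def Prog.forN (x y : ℕ) (p : Prog) : Prog :=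
  .seq (.assign x (.const 0)) (.loop (.sub (.var y) (.var x))
    (.seq p (.assign x (.add (.var x) (.const 1)))))

/-- The counter is incremented after the body, so the body must establish the invariant for the
memory after the increment. A round costs the body, the test and the increment, rounded up to three
extra units. The counter never exceeds the value of `y` and so stays below `B`. -/
theorem Tri.forN {B : ℕ} {p : Prog} {σ : State} {T : ℕ} {Q : State → Prop} {x y : ℕ}
    (N : ℕ) (I : ℕ → State → Prop) (hxy : y ∉ x :: p.wv) (hx : x ∉ p.wv)
    (hN : σ.var y = N) (h0 : I 0 (σ.setVar x 0))
    (hs : ∀ i < N, ∀ τ, Frame (x :: p.wv) p.wa σ τ → τ.var x = i → I i τ →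
      Tri B p τ T fun υ => I (i + 1) (υ.setVar x (i + 1)))
    (hQ : ∀ τ, Frame (x :: p.wv) p.wa σ τ → τ.var x = N → I N τ → Q τ) :
    Tri B (.forN x y p) σ (2 + N * (T + 3)) Q := by
  have hcost : ∀ τ, Bdd B τ →
      (Expr.sub (.var y) (.var x)).cost τ + 1 ≤ unitCost B := fun τ hτ => by
    have := (Expr.sub (.var y) (.var x)).cost_le_unit hτ (by simp [Expr.nodes])
    unfold unitCost; omega
  have key : ∀ k i, i + k = N → ∀ τ, Frame (x :: p.wv) p.wa σ τ → τ.var x = i → I i τ →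
      Tri B (.loop (.sub (.var y) (.var x)) (.seq p (.assign x (.add (.var x) (.const 1)))))
        τ (1 + k * (T + 3)) Q := by
    intro k
    induction k with
    | zero =>
      intro i hi τ hF hxi hI hB
      have hyi := hF.1 y hxy
      have h0 : (Expr.sub (.var y) (.var x)).eval τ = 0 := by
        simp only [Expr.eval]; omega
      refine ⟨τ, _, Runs.loop_false h0, ?_, hB, hQ τ hF (by omega) (by simpa [← hi] using hI)⟩
      have := hcost τ hB
      omega
    | succ k ih =>
      intro i hi τ hF hxi hI hB
      have hyi := hF.1 y hxy
      have h0 : (Expr.sub (.var y) (.var x)).eval τ ≠ 0 := by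
        simp only [Expr.eval]; omega
      have hbody := Tri.framed (hs i (by omega) τ hF hxi hI)
        (Q' := fun υ => Tri B (.assign x (.add (.var x) (.const 1))) υ 1 fun υ =>
          Frame (x :: p.wv) p.wa σ υ ∧ υ.var x = i + 1 ∧ I (i + 1) υ) (by
        intro υ hυ hIυ
        have hxυ : υ.var x = i := (hυ.1 x hx).trans hxi
        refine Tri.of_bdd fun _ => Tri.assign (by simp [Expr.nodes]) ?_ ?_
        · have := hB.1 y
          simp only [Expr.eval]; omega
        · simp only [Expr.eval, hxυ]
          refine ⟨(hF.trans (hυ.mono (List.subset_cons_self _ _) (List.Subset.refl _))).trans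
            ⟨fun z hz => ?_, fun _ _ => rfl⟩, by simp, hIυ⟩
          simp only [List.mem_cons, not_or] at hz
          simp [hz.1])
      obtain ⟨υ, s, h1, h2, h3, h4, h5, h6⟩ := Tri.seq hbody hB
      obtain ⟨ω, t, h1', h2', h3', h4'⟩ := ih (i + 1) (by omega) υ h4 h5 h6 h3
      refine ⟨ω, _, Runs.loop_true h0 h1 h1', ?_, h3', h4'⟩
      have := hcost τ hB
      have e : (1 + (k + 1) * (T + 3)) * unitCost B = (T + 1) * unitCost B +
        (1 + k * (T + 3)) * unitCost B + unitCost B + unitCost B := by ring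
      omega
  have e : 2 + N * (T + 3) = 1 + (1 + N * (T + 3)) := by omega
  rw [e]
  refine Tri.seq (Tri.assign (by simp [Expr.nodes]) (by simp [Expr.eval]) ?_)
  refine key N 0 (by omega) _ ⟨fun z hz => ?_, fun _ _ => rfl⟩ (by simp [Expr.eval]) h0
  simp only [List.mem_cons, not_or] at hz
  simp [hz.1]

end RAM

/-! ### Degree keys, component labels and pivots -/

namespace Reduction

/-! ### Degree sequences as ternary numbers -/

/-- The number of `v < k` with `c v ≠ 0`. -/
def rk (c : ℕ → ℕ) (k : ℕ) : ℕ := Nat.count (fun v => c v ≠ 0) k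

@[simp] theorem rk_zero (c : ℕ → ℕ) : rk c 0 = 0 := rfl

theorem rk_succ (c : ℕ → ℕ) (k : ℕ) : rk c (k + 1) = if c k = 0 then rk c k else rk c k + 1 := by
  unfold rk
  rw [Nat.count_succ]
  split_ifs <;> simp_all

theorem rk_mono (c : ℕ → ℕ) {k l : ℕ} (h : k ≤ l) : rk c k ≤ rk c l := Nat.count_monotone _ h

/-- The number with ternary digits `d v`, where `v` runs over the `v < k` with `c v ≠ 0`. -/
def key (c d : ℕ → ℕ) : ℕ → ℕ
  | 0 => 0
  | k + 1 => if c k = 0 then key c d k else 3 * key c d k + d k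

theorem key_lt {c d : ℕ → ℕ} (k : ℕ) (h : ∀ v < k, c v ≠ 0 → d v ≤ 2) :
    key c d k < 3 ^ rk c k := by
  induction k with
  | zero => simp [key]
  | succ k ih =>
    have := ih fun v hv => h v (by omega)
    rw [key, rk_succ]
    split_ifs with hc
    · exact this
    · have := h k (by omega) hc
      rw [pow_succ]; omega

/-- Digits may exceed 2 here, as the number is computed before the degrees are known to be small.
The summand `N` on the left carries the induction. -/
theorem key_add_le {c d : ℕ → ℕ} {N : ℕ} (k : ℕ) (h : ∀ v < k, d v ≤ N) :
    key c d k + N ≤ N * 3 ^ rk c k := by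
  induction k with
  | zero => simp [key]
  | succ k ih =>
    have := ih fun v hv => h v (by omega)
    rw [key, rk_succ]
    split_ifs with hc
    · exact this
    · have := h k (by omega)
      rw [pow_succ, ← mul_assoc]; omega

theorem eq_of_key_eq {c d d' : ℕ → ℕ} (k : ℕ) (h : ∀ v < k, c v ≠ 0 → d v ≤ 2)
    (h' : ∀ v < k, c v ≠ 0 → d' v ≤ 2) (he : key c d k = key c d' k) :
    ∀ v < k, c v ≠ 0 → d v = d' v := by
  induction k with
  | zero => intro v hv; omega
  | succ k ih =>
    have ih := ih (fun v hv => h v (by omega)) fun v hv => h' v (by omega)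
    rw [key, key] at he
    intro v hv hcv
    rcases Nat.lt_succ_iff_lt_or_eq.1 hv with hv | rfl
    · refine ih ?_ v hv hcv
      split_ifs at he with hc
      · exact he
      · have := h k (by omega) hc
        have := h' k (by omega) hc
        omega
    · rw [if_neg hcv, if_neg hcv] at he
      have := h v (by omega) hcv
      have := h' v (by omega) hcv
      omega

theorem key_congr {c d d' : ℕ → ℕ} (k : ℕ) (h : ∀ v < k, d v = d' v) :
    key c d k = key c d' k := by
  induction k with
  | zero => rfl
  | succ k ih => rw [key, key, ih fun v hv => h v (by omega), h k (by omega)]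

/-! ### Components through labels -/

/-- The colouring `f` is constant along all pairs of the relation `E` below `n`. -/
def Respects (n : ℕ) (E : ℕ → ℕ → Prop) (f : ℕ → ZMod 2) : Prop :=
  ∀ a < n, ∀ b < n, E a b → f a = f b

/-- `lab` labels the points below `n` by representatives of the components of `E`. -/
structure Labels (n : ℕ) (E : ℕ → ℕ → Prop) (lab : ℕ → ℕ) : Prop where
  lt : ∀ x < n, lab x < n
  idem : ∀ x < n, lab (lab x) = lab x
  respects_iff : ∀ f, Respects n E f ↔ ∀ x < n, f x = f (lab x)

theorem Labels.init {n : ℕ} {E : ℕ → ℕ → Prop} {lab : ℕ → ℕ} (hE : ∀ a < n, ∀ b < n, ¬ E a b)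
    (h : ∀ x < n, lab x = x) : Labels n E lab where
  lt x hx := by rwa [h x hx]
  idem x hx := by rw [h x hx, h x hx]
  respects_iff f := ⟨fun _ x hx => by rw [h x hx], fun _ a ha b hb hab => absurd hab (hE a ha b hb)⟩

theorem Labels.congr {n : ℕ} {E E' : ℕ → ℕ → Prop} {lab : ℕ → ℕ} (h : Labels n E lab)
    (hE : ∀ a < n, ∀ b < n, E a b ↔ E' a b) : Labels n E' lab where
  lt := h.lt
  idem := h.idem
  respects_iff f := by
    rw [← h.respects_iff]
    exact ⟨fun H a ha b hb hab => H a ha b hb ((hE a ha b hb).1 hab),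
      fun H a ha b hb hab => H a ha b hb ((hE a ha b hb).2 hab)⟩

/-- Components enter only through the colourings constant on them. Respecting the enlarged relation
means respecting the old one and having `f u = f v`, which is what renaming the class of `v`
expresses. -/
theorem Labels.merge {n : ℕ} {E E' : ℕ → ℕ → Prop} {lab lab' : ℕ → ℕ} (h : Labels n E lab)
    {u v : ℕ} (hu : u < n) (hv : v < n)
    (hE : ∀ a < n, ∀ b < n, E' a b ↔ E a b ∨ (a = u ∧ b = v))
    (hl : ∀ x < n, lab' x = if lab x = lab v then lab u else lab x) : Labels n E' lab' where
  lt x hx := by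
    rw [hl x hx]; split_ifs
    exacts [h.lt u hu, h.lt x hx]
  idem x hx := by
    have hux := h.lt u hu
    have hxx := h.lt x hx
    have h1 := h.idem u hu
    have h2 := h.idem x hx
    rw [hl x hx]
    split_ifs with h3
    · rw [hl _ hux, h1]; split_ifs <;> rfl
    · rw [hl _ hxx, h2, if_neg h3]
  respects_iff f := by
    have key : Respects n E' f ↔ Respects n E f ∧ f u = f v := by
      constructor
      · intro H
        exact ⟨fun a ha b hb hab => H a ha b hb ((hE a ha b hb).2 (Or.inl hab)),
          H u hu v hv ((hE u hu v hv).2 (Or.inr ⟨rfl, rfl⟩))⟩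
      · rintro ⟨H, H'⟩ a ha b hb hab
        rcases (hE a ha b hb).1 hab with h1 | ⟨rfl, rfl⟩
        exacts [H a ha b hb h1, H']
    rw [key, h.respects_iff]
    constructor
    · rintro ⟨H, H'⟩ x hx
      rw [hl x hx]
      split_ifs with h1
      · rw [← H u hu, H', H v hv, ← h1, ← H x hx]
      · exact H x hx
    · intro H
      -- Both branches leave `u` with the label `lab u`.
      have hlu : f u = f (lab u) := by
        have := H u hu
        rw [hl u hu] at this
        split_ifs at this <;> exact this
      have hlv : f v = f (lab u) := by
        have := H v hv
        rwa [hl v hv, if_pos rfl] at this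
      have hllv : f (lab v) = f (lab u) := by
        have := H _ (h.lt v hv)
        rwa [hl _ (h.lt v hv), if_pos (h.idem v hv)] at this
      refine ⟨fun x hx => ?_, hlu.trans hlv.symm⟩
      have := H x hx
      rw [hl x hx] at this
      split_ifs at this with h1
      · rw [this, h1, hllv]
      · exact this

/-- The number of neighbours of `v` below `n`. -/
noncomputable def degN (n : ℕ) (E : ℕ → ℕ → Prop) (v : ℕ) : ℕ :=
  open Classical in Nat.count (E v) n

/-- The conditions on `E` that are necessary for a completion to a Hamiltonian cycle. -/
def Valid (n : ℕ) (a c : ℕ → ℕ) (E : ℕ → ℕ → Prop) : Prop :=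
  ∀ v < n, (c v ≠ 0 → degN n E v ≤ 2) ∧ (c v = 0 → a v ≠ 0 → degN n E v = 2 ∧
    ∃ u < n, c u ≠ 0 ∧ ∀ f, Respects n E f → f u = f v)

/-- The number of the degree sequence of `E` on `c`. -/
noncomputable def degKey (n : ℕ) (c : ℕ → ℕ) (E : ℕ → ℕ → Prop) : ℕ := key c (degN n E) n

/-- The colouring of the support of `c` with number `j`. -/
def colour (c : ℕ → ℕ) (j v : ℕ) : ℕ := j / 2 ^ rk c v % 2

/-- The indicator vector of the colourings of `c` that extend to colourings respecting `E`. -/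
noncomputable def cutVec (n : ℕ) (c : ℕ → ℕ) (E : ℕ → ℕ → Prop) : Fin (2 ^ rk c n) → ZMod 2 :=
  open Classical in fun j => if ∃ f, Respects n E f ∧ ∀ v < n, c v ≠ 0 → f v = (colour c j v : ℕ)
    then 1 else 0

/-! ### Echelon bases -/

/-- The vector with the first `N` entries of `w`. -/
def toVec (N : ℕ) (w : ℕ → ℕ) : Fin N → ZMod 2 := fun j => (w j : ZMod 2)

/-- The echelon basis: for `D < M` and `f < N` with `ptr (D + f * M) ≠ 0`, the cells of `rows` from
`ptr (D + f * M)` on hold a vector in `U D` whose leading entry is entry `f`. -/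
structure Pivots (N M : ℕ) (U : ℕ → Submodule (ZMod 2) (Fin N → ZMod 2)) (ptr rows : ℕ → ℕ)
    (top : ℕ) : Prop where
  pos : 0 < top
  le_top : ∀ D < M, ∀ f < N, ptr (D + f * M) ≠ 0 → ptr (D + f * M) + N ≤ top
  le_one : ∀ D < M, ∀ f < N, ptr (D + f * M) ≠ 0 → ∀ j < N, rows (ptr (D + f * M) + j) ≤ 1
  lead : ∀ D < M, ∀ f < N, ptr (D + f * M) ≠ 0 → rows (ptr (D + f * M) + f) = 1
  zero : ∀ D < M, ∀ f < N, ptr (D + f * M) ≠ 0 → ∀ j < f, rows (ptr (D + f * M) + j) = 0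
  mem : ∀ D < M, ∀ f < N, ptr (D + f * M) ≠ 0 →
    toVec N (fun j => rows (ptr (D + f * M) + j)) ∈ U D

theorem pair_inj {M D f D' f' : ℕ} (hD : D < M) (hD' : D' < M) (h : D + f * M = D' + f' * M) :
    D = D' ∧ f = f' := by
  have h1 : D = D' := by
    have := congrArg (· % M) h
    simpa [Nat.mod_eq_of_lt hD, Nat.mod_eq_of_lt hD'] using this
  subst h1
  refine ⟨rfl, Nat.eq_of_mul_eq_mul_right (by omega : 0 < M) (by omega)⟩

theorem toVec_congr {N : ℕ} {w w' : ℕ → ℕ} (h : ∀ j < N, w j = w' j) : toVec N w = toVec N w' := by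
  funext j
  simp only [toVec, h j j.2]

/-- The new row occupies fresh cells from `top` on, so older rows are untouched. Positivity of `top`
matters because the pointer 0 stands for an absent row. -/
theorem Pivots.insert {N M : ℕ} {U U' : ℕ → Submodule (ZMod 2) (Fin N → ZMod 2)}
    {ptr rows rows' : ℕ → ℕ} {top : ℕ} (h : Pivots N M U ptr rows top) (hU : ∀ D, U D ≤ U' D)
    {D f : ℕ} (hD : D < M) {w : ℕ → ℕ} (hw : ∀ j < N, w j ≤ 1) (hwf : w f = 1)
    (hw0 : ∀ j < f, w j = 0) (hwU : toVec N w ∈ U' D) (hf : f < N)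
    (hr : ∀ j < top, rows' j = rows j) (hr' : ∀ j < N, rows' (top + j) = w j) :
    Pivots N M U' (Function.update ptr (D + f * M) top) rows' (top + N) := by
  have key : ∀ {D'}, D' < M → ∀ {f'}, f' < N →
      Function.update ptr (D + f * M) top (D' + f' * M) ≠ 0 →
      (D' = D ∧ f' = f ∧ Function.update ptr (D + f * M) top (D' + f' * M) = top) ∨
      (Function.update ptr (D + f * M) top (D' + f' * M) = ptr (D' + f' * M) ∧
        ptr (D' + f' * M) ≠ 0 ∧ ∀ j < N, rows' (ptr (D' + f' * M) + j) =
          rows (ptr (D' + f' * M) + j)) := by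
    intro D' hD' f' hf' hne
    by_cases he : D' + f' * M = D + f * M
    · obtain ⟨rfl, rfl⟩ := pair_inj hD' hD he
      left; simp
    · right
      rw [Function.update_of_ne he] at hne ⊢
      refine ⟨rfl, hne, fun j hj => hr _ ?_⟩
      have := h.le_top D' hD' f' hf' hne
      omega
  constructor
  · have := h.pos; omega
  · intro D' hD' f' hf' hne
    rcases key hD' hf' hne with ⟨-, -, h3⟩ | ⟨h1, h2, h3⟩
    · omega
    · have := h.le_top D' hD' f' hf' h2
      omega
  · intro D' hD' f' hf' hne
    rcases key hD' hf' hne with ⟨-, -, h3⟩ | ⟨h1, h2, h3⟩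
    · intro j hj; rw [h3, hr' j hj]; exact hw j hj
    · intro j hj; rw [h1, h3 j hj]; exact h.le_one D' hD' f' hf' h2 j hj
  · intro D' hD' f' hf' hne
    rcases key hD' hf' hne with ⟨-, rfl, h3⟩ | ⟨h1, h2, h3⟩
    · rw [h3, hr' _ hf']; exact hwf
    · rw [h1, h3 _ hf']; exact h.lead D' hD' f' hf' h2
  · intro D' hD' f' hf' hne
    rcases key hD' hf' hne with ⟨-, rfl, h3⟩ | ⟨h1, h2, h3⟩
    · intro j hj; rw [h3, hr' _ (by omega)]; exact hw0 j hj
    · intro j hj; rw [h1, h3 _ (by omega)]; exact h.zero D' hD' f' hf' h2 j hj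
  · intro D' hD' f' hf' hne
    rcases key hD' hf' hne with ⟨rfl, -, h3⟩ | ⟨h1, h2, h3⟩
    · rw [h3, toVec_congr hr']; exact hwU
    · rw [h1, toVec_congr h3]; exact hU _ (h.mem D' hD' f' hf' h2)

/-- The number of pivots. -/
def pivotCount (K : ℕ) (ptr : ℕ → ℕ) : ℕ := ((Finset.range K).filter fun q => ptr q ≠ 0).card

theorem pivotCount_le (K : ℕ) (ptr : ℕ → ℕ) : pivotCount K ptr ≤ K :=
  (Finset.card_filter_le _ _).trans (Finset.card_range K).le

theorem pivotCount_update {K q top : ℕ} {ptr : ℕ → ℕ} (hq : q < K) (h0 : ptr q = 0)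
    (ht : top ≠ 0) : pivotCount K (Function.update ptr q top) = pivotCount K ptr + 1 := by
  unfold pivotCount
  have : (Finset.range K).filter (fun r => Function.update ptr q top r ≠ 0) =
      insert q ((Finset.range K).filter fun r => ptr r ≠ 0) := by
    ext r
    simp only [Finset.mem_filter, Finset.mem_insert, Finset.mem_range]
    by_cases hr : r = q
    · subst hr; simp [hq, ht]
    · simp [hr]
  rw [this, Finset.card_insert_of_notMem (by simp [h0])]

end Reduction

/-! ### The program: preparation and analysis of one edge set -/

namespace Reduction

open RAM

theorem degN_succ (E : ℕ → ℕ → Prop) (u k : ℕ) [Decidable (E u k)] :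
    degN (k + 1) E u = if E u k then degN k E u + 1 else degN k E u := by
  classical
  unfold degN
  rw [Nat.count_succ]
  split_ifs <;> simp_all

theorem degN_le (E : ℕ → ℕ → Prop) (u k : ℕ) : degN k E u ≤ k := by
  classical
  exact Nat.count_le _

/-- Compute the powers of `2` and `3` with exponent the size of the separator. -/
def powers : Prog :=
  .seq (.assign 3 (.const 1)) (.seq (.assign 4 (.const 1)) (.forN 8 0
    (.cond (.load 2 (.var 8))
      (.seq (.assign 3 (.add (.var 3) (.var 3)))
        (.assign 4 (.add (.add (.var 4) (.var 4)) (.var 4)))) .skip)))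

theorem powers_spec {B n : ℕ} {c : ℕ → ℕ} {σ : State} (hn : σ.var 0 = n) (hc : σ.arr 2 = c)
    (hB : 3 ^ rk c n ≤ B) :
    Tri B powers σ (4 + n * 7) fun τ => τ.var 3 = 2 ^ rk c n ∧ τ.var 4 = 3 ^ rk c n := by
  have h1B : 1 ≤ B := (Nat.one_le_pow _ _ (by norm_num)).trans hB
  refine Tri.le (Tri.seq (Tri.assign (by decide) (by simpa [Expr.eval]) (Tri.seq (Tri.assign
    (by decide) (by simpa [Expr.eval]) (Tri.forN n
      (fun i τ => τ.var 3 = 2 ^ rk c i ∧ τ.var 4 = 3 ^ rk c i) (by decide) (by decide)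
      (by simpa using hn) (by simp [Expr.eval]) ?_ ?_))))) (T := 1 + (1 + (2 + n * (3 + 1 + 3))))
      (by omega)
  · rintro i hi τ hF h8 ⟨h3, h4⟩
    have hc' : τ.arr 2 = c := by rw [hF.2 2 (by decide)]; simpa using hc
    refine Tri.cond (T := 1 + 1) (T' := 1) (by decide) (fun he => ?_) (fun he => Tri.skip ?_) |>.le
      (by omega) <;> simp only [Expr.eval, hc', h8] at he
    · have hr : rk c (i + 1) = rk c i + 1 := by rw [rk_succ, if_neg he]
      have hle := rk_mono c (show i + 1 ≤ n from hi)
      have h3B : 3 ^ (rk c i + 1) ≤ B := (Nat.pow_le_pow_right (by norm_num) (hr ▸ hle)).trans hB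
      have h2B : 2 ^ (rk c i + 1) ≤ B := (Nat.pow_le_pow_left (by norm_num) _).trans h3B
      rw [pow_succ] at h2B h3B
      refine Tri.seq (Tri.assign (by decide) (by simp only [Expr.eval]; omega) (Tri.assign
        (by decide) (by simp [Expr.eval]; omega) ?_))
      simp [Expr.eval, h3, h4, hr, pow_succ]; omega
    · simp [h3, h4, rk_succ, he]
  · rintro τ - - h
    exact h

/-- Tabulate quotients and remainders modulo `2`. -/
def halves : Prog :=
  .forN 15 3 (.seq (.store 5 (.add (.var 15) (.var 15)) (.var 15))
    (.seq (.store 5 (.add (.add (.var 15) (.var 15)) (.const 1)) (.var 15))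
    (.seq (.store 6 (.add (.var 15) (.var 15)) (.const 0))
      (.store 6 (.add (.add (.var 15) (.var 15)) (.const 1)) (.const 1)))))

/-- The machine cannot divide. Writing `i` and the parities into the cells 2i and 2i + 1 produces
the tables by additions alone, over twice the range that is needed. -/
theorem halves_spec {B N : ℕ} {σ : State} (hN : σ.var 3 = N) (hB : 1 ≤ B) :
    Tri B halves σ (2 + N * 7) fun τ => ∀ r < N, τ.arr 5 r = r / 2 ∧ τ.arr 6 r = r % 2 := by
  refine Tri.forN N (fun i τ => ∀ r < 2 * i, τ.arr 5 r = r / 2 ∧ τ.arr 6 r = r % 2) (by decide)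
    (by decide) hN (by simp) (T := 1 + (1 + (1 + 1))) ?_ ?_
  · rintro i hi τ hF h15 hI
    refine Tri.of_bdd fun hb => Tri.seq (Tri.store (by decide) (by decide) (hb.1 _) (Tri.seq
      (Tri.store (by decide) (by decide) (hb.1 _) (Tri.seq (Tri.store (by decide) (by decide)
        (by simp [Expr.eval]) (Tri.store (by decide) (by decide) (by simpa [Expr.eval]) ?_))))))
    intro r hr
    simp only [Expr.eval, State.arr_setVar, State.arr_setArr, State.var_setArr, h15, if_true,
      Function.update_apply, reduceIte, Nat.reduceEqDiff]
    by_cases h1 : r = i + i + 1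
    · simp [h1]; omega
    by_cases h2 : r = i + i
    · simp [h2]; omega
    · simp [h1, h2]; exact hI r (by omega)
  · intro τ _ _ h r hr
    exact h r (by omega)

/-- Reset the tables of one edge set. -/
def reset : Prog :=
  .forN 8 0 (.seq (.store 7 (.var 8) (.const 0)) (.seq (.store 8 (.var 8) (.var 8))
    (.store 9 (.var 8) (.const 0))))

theorem reset_spec {B n : ℕ} {σ : State} (hn : σ.var 0 = n) :
    Tri B reset σ (2 + n * 6) fun τ => ∀ x < n, τ.arr 7 x = 0 ∧ τ.arr 8 x = x ∧ τ.arr 9 x = 0 := by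
  refine Tri.forN n (fun i τ => ∀ x < i, τ.arr 7 x = 0 ∧ τ.arr 8 x = x ∧ τ.arr 9 x = 0) (by decide)
    (by decide) hn (by simp) (T := 1 + (1 + 1)) ?_ fun _ _ _ h => h
  rintro i hi τ hF h8 hI
  refine Tri.of_bdd fun hb => Tri.seq (Tri.store (by decide) (by decide) (by simp [Expr.eval])
    (Tri.seq (Tri.store (by decide) (by decide) (hb.1 _) (Tri.store (by decide) (by decide)
      (by simp [Expr.eval]) ?_))))
  intro x hx
  simp only [Expr.eval, State.arr_setVar, State.arr_setArr, State.var_setArr, h8,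
    Function.update_apply, reduceIte, Nat.reduceEqDiff]
  by_cases h1 : x = i
  · simp [h1]
  · simp [h1]; exact hI x (by omega)

/-- Replace the label in variable `12` by the label in variable `11`. -/
def relabel : Prog :=
  .forN 10 0 (.cond (.add (.sub (.load 8 (.var 10)) (.var 12)) (.sub (.var 12) (.load 8 (.var 10))))
    .skip (.store 8 (.var 10) (.var 11)))

/-- With truncated subtraction, (x - y) + (y - x) vanishes exactly when x = y; this is the equality
test of the program. Both labels sit in variables, since the cells they came from may be overwritten
on the way. -/
theorem relabel_spec {B n : ℕ} {lab : ℕ → ℕ} {σ : State} (hn : σ.var 0 = n)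
    (hl : σ.arr 8 = lab) :
    Tri B relabel σ (2 + n * 6) fun τ => ∀ x < n, τ.arr 8 x =
      if lab x = σ.var 12 then σ.var 11 else lab x := by
  refine Tri.forN n (fun i τ => ∀ x, τ.arr 8 x =
    if x < i ∧ lab x = σ.var 12 then σ.var 11 else lab x) (by decide) (by decide) hn
    (by simp [hl]) (T := 1 + 1 + 1) ?_ ?_
  · rintro i hi τ hF h10 hI
    have h11 := hF.1 11 (by decide)
    have h12 := hF.1 12 (by decide)
    have hIi := hI i
    rw [if_neg (by omega)] at hIi
    refine Tri.of_bdd fun hb => Tri.cond (by decide) (fun he => Tri.skip ?_)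
      fun he => Tri.store (by decide) (by decide) (hb.1 _) ?_ <;> intro x <;>
      simp only [Expr.eval, h10, h12, hIi] at he <;>
      simp only [Expr.eval, State.arr_setVar, State.arr_setArr, h10, h11, reduceIte,
        Function.update_apply, hI x]
    · by_cases hx : x = i
      · subst hx
        rw [if_neg (by omega), if_neg (by omega)]
      · simp only [show x < i + 1 ↔ x < i by omega]
    · by_cases hx : x = i
      · subst hx
        rw [if_pos rfl, if_pos (by omega)]
      · simp only [show x < i + 1 ↔ x < i by omega, hx, if_false]
  · intro τ _ _ h x hx
    simp [h x, hx]

/-- The edges of the edge set that is stored in `W` from cell `b` on. -/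
def EdgeAt (W : ℕ → ℕ) (n b u v : ℕ) : Prop := W (b + (u * n + v)) ≠ 0

instance (W : ℕ → ℕ) (n b u v : ℕ) : Decidable (EdgeAt W n b u v) :=
  inferInstanceAs (Decidable (_ ≠ _))

/-- Process one entry of the adjacency matrix. -/
def scanEdge : Prog :=
  .seq (.cond (.load 3 (.var 6))
    (.seq (.store 7 (.var 8) (.add (.load 7 (.var 8)) (.const 1)))
    (.seq (.assign 11 (.load 8 (.var 8))) (.seq (.assign 12 (.load 8 (.var 9))) relabel)))
    .skip) (.assign 6 (.add (.var 6) (.const 1)))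

/-- Compute the degrees and the component labels of the current edge set. -/
def scan : Prog := .seq (.assign 6 (.var 5)) (.forN 8 0 (.forN 9 0 scanEdge))

/-- Degrees and labels always belong to the relation cut down to the matrix entries before the
current one, in row order. Symmetry of the matrix is not needed: every entry is merged on its own.
-/
theorem scan_spec {B n b : ℕ} {W : ℕ → ℕ} {σ : State} (hn : σ.var 0 = n) (hb : σ.var 5 = b)
    (hW : σ.arr 3 = W) (h7 : ∀ x < n, σ.arr 7 x = 0) (h8 : ∀ x < n, σ.arr 8 x = x)
    (hB : b + n * n ≤ B) (hnB : n ≤ B) :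
    Tri B scan σ (3 + n * (5 + n * (11 + n * 6))) fun τ =>
      τ.var 6 = b + n * n ∧ (∀ x < n, τ.arr 7 x = degN n (EdgeAt W n b) x) ∧
        Labels n (EdgeAt W n b) (τ.arr 8) := by
  set E := EdgeAt W n b with hE
  refine Tri.le (Tri.seq (Tri.of_bdd fun hb => Tri.assign (by decide) (hb.1 _) (Tri.forN n
    (fun u τ => τ.var 6 = b + u * n ∧ (∀ x < n, τ.arr 7 x = if x < u then degN n E x else 0) ∧
      Labels n (fun a b => E a b ∧ a < u) (τ.arr 8)) (by decide) (by decide) (by simpa using hn)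
      ?_ (T := 2 + n * (((1 + (1 + (1 + (2 + n * 6)))) + 1 + 1 + 1) + 3)) ?_ ?_))) ?_
  · refine ⟨by simp [Expr.eval, ‹σ.var 5 = b›], by simpa using h7, ?_⟩
    exact Labels.init (by simp) (by simpa using h8)
  · rintro u hu τ hF hu8 ⟨h6, hdeg, hlab⟩
    have hn' : τ.var 0 = n := by rw [hF.1 0 (by decide)]; simpa using hn
    have hW' : τ.arr 3 = W := by rw [hF.2 3 (by decide)]; simpa using hW
    refine Tri.forN n (fun v τ => τ.var 6 = b + (u * n + v) ∧ (∀ x < n, τ.arr 7 x =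
      if x < u then degN n E x else if x = u then degN v E u else 0) ∧
      Labels n (fun a b => E a b ∧ (a < u ∨ a = u ∧ b < v)) (τ.arr 8)) (by decide) (by decide) hn'
      ?_ ?_ ?_
    · refine ⟨by simp [h6], fun x hx => ?_, ?_⟩
      · rw [State.arr_setVar, hdeg x hx]
        simp [degN]
      · simpa using hlab
    · rintro v hv υ hF' hv9 ⟨h6, hdeg, hlab⟩
      have hn'' : υ.var 0 = n := by rw [hF'.1 0 (by decide)]; exact hn'
      have hW'' : υ.arr 3 = W := by rw [hF'.2 3 (by decide)]; exact hW'
      have hu8' : υ.var 8 = u := by rw [hF'.1 8 (by decide)]; exact hu8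
      have hpB : b + (u * n + v) + 1 ≤ B := by nlinarith
      refine Tri.seq (T := (1 + (1 + (1 + (2 + n * 6)))) + 1 + 1) (T' := 1) ?_
      refine Tri.cond (by decide) (fun he => ?_) (fun he => Tri.skip ?_)
        <;> simp only [Expr.eval, h6, hW''] at he
      · have hEuv : E u v := he
        have hd1 : υ.arr 7 u + 1 ≤ B := by
          rw [hdeg u hu]
          have := degN_le E u v
          simp; omega
        refine Tri.seq (Tri.store (by decide) (by decide) (by simpa [Expr.eval, hu8'] using hd1) ?_)
        refine Tri.seq (Tri.of_bdd fun hb => Tri.assign (by decide) (hb.2 _ _) ?_)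
        refine Tri.seq (Tri.of_bdd fun hb => Tri.assign (by decide) (hb.2 _ _) ?_)
        refine Tri.framed (relabel_spec (by simpa using hn'') rfl) ?_
        intro ω hω hl
        have h6' : ω.var 6 = b + (u * n + v) := by rw [hω.1 6 (by decide)]; simpa using h6
        have h8' : ω.var 8 = u := by rw [hω.1 8 (by decide)]; simpa using hu8'
        have h7' := hω.2 7 (by decide)
        simp [Expr.eval, hu8', hv9] at h7' hl
        refine Tri.assign (by decide) (by simp [Expr.eval, h6']; omega)
          ⟨by simp [Expr.eval, h6', add_assoc], fun x hx => ?_, ?_⟩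
        · simp only [State.arr_setVar, h7', Function.update_apply]
          by_cases hxu : x = u
          · subst hxu
            simp [hdeg x hx, degN_succ, hEuv]
          · simp [hxu, hdeg x hx]
        · refine hlab.merge hu hv (fun x hx y hy => ?_) (by simpa using hl)
          constructor
          · rintro ⟨h1, h2⟩
            by_cases h3 : x = u ∧ y = v
            · exact Or.inr h3
            · exact Or.inl ⟨h1, by omega⟩
          · rintro (⟨h1, h2⟩ | ⟨rfl, rfl⟩)
            · exact ⟨h1, by omega⟩
            · exact ⟨hEuv, by omega⟩
      · have hEuv : ¬ E u v := by simpa [hE, EdgeAt] using he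
        refine Tri.assign (by decide) (by simp [Expr.eval, h6]; omega)
          ⟨by simp [Expr.eval, h6, add_assoc], fun x hx => ?_, ?_⟩
        · simp [hdeg x hx, degN_succ, hEuv]
        · refine hlab.congr fun x hx y hy => ?_
          refine and_congr_right fun h1 => ?_
          have : ¬ (x = u ∧ y = v) := by rintro ⟨rfl, rfl⟩; exact hEuv h1
          omega
    · rintro υ hF' - ⟨h6, hdeg, hlab⟩
      refine ⟨by simp [h6]; ring, fun x hx => ?_, ?_⟩
      · simp only [State.arr_setVar, hdeg x hx]
        by_cases hxu : x = u
        · subst hxu; simp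
        · simp [show x < u + 1 ↔ x < u by omega, hxu]
      · refine hlab.congr fun x hx y hy => and_congr_right fun _ => ?_
        omega
  · rintro τ hF - ⟨h6, hdeg, hlab⟩
    refine ⟨h6, fun x hx => by simp [hdeg x hx, hx], hlab.congr fun x hx y hy => ?_⟩
    simp [hx]
  · exact le_of_eq (by ring)

/-- Choose a representative in the separator for every label. -/
def hits : Prog :=
  .forN 8 0 (.cond (.load 2 (.var 8))
    (.store 9 (.load 8 (.var 8)) (.add (.var 8) (.const 1))) .skip)

/-- Representatives are stored as `u + 1`, so that 0 marks a component missing the separator. Later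
vertices overwrite earlier ones; any representative will do. -/
theorem hits_spec {B n : ℕ} {c lab : ℕ → ℕ} {σ : State} (hn : σ.var 0 = n) (hc : σ.arr 2 = c)
    (hl : σ.arr 8 = lab) (h9 : ∀ x < n, σ.arr 9 x = 0) (hB : n ≤ B) :
    Tri B hits σ (2 + n * 6) fun τ =>
      (∀ x < n, τ.arr 9 x ≠ 0 → ∃ u < n, τ.arr 9 x = u + 1 ∧ c u ≠ 0 ∧ lab u = x) ∧
      ∀ u < n, c u ≠ 0 → τ.arr 9 (lab u) ≠ 0 := by
  refine Tri.forN n (fun i τ =>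
      (∀ x < n, τ.arr 9 x ≠ 0 → ∃ u < n, τ.arr 9 x = u + 1 ∧ c u ≠ 0 ∧ lab u = x) ∧
      ∀ u < i, c u ≠ 0 → τ.arr 9 (lab u) ≠ 0) (by decide) (by decide) hn
      ⟨fun x hx h => absurd (h9 x hx) h, by simp⟩ (T := 1 + 1 + 1) ?_ fun _ _ _ h => h
  rintro i hi τ hF h8 ⟨hI, hI'⟩
  have hc' : τ.arr 2 = c := by rw [hF.2 2 (by decide)]; simpa using hc
  have hl' : τ.arr 8 = lab := by rw [hF.2 8 (by decide)]; simpa using hl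
  refine Tri.cond (by decide) (fun he => Tri.store (by decide) (by decide) ?_ ⟨?_, ?_⟩)
    fun he => Tri.skip ⟨hI, ?_⟩ <;> simp only [Expr.eval, h8, hc'] at he
  · simp [Expr.eval, h8]; omega
  · intro x hx
    simp only [Expr.eval, h8, hl', State.arr_setVar, State.arr_setArr, reduceIte,
      Function.update_apply]
    by_cases hxl : x = lab i
    · intro _
      exact ⟨i, hi, by simp [hxl], he, hxl.symm⟩
    · rw [if_neg hxl]; exact hI x hx
  · intro u hu hcu
    simp only [Expr.eval, h8, hl', State.arr_setVar, State.arr_setArr, reduceIte,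
      Function.update_apply]
    split_ifs with h1
    · omega
    · refine hI' u ?_ hcu
      rcases Nat.lt_succ_iff_lt_or_eq.1 hu with h | rfl
      exacts [h, absurd rfl h1]
  · intro u hu hcu
    rcases Nat.lt_succ_iff_lt_or_eq.1 hu with h | rfl
    exacts [hI' u h hcu, absurd he hcu]

/-- Decide validity of the current edge set and compute the number of its degree sequence. -/
def check : Prog :=
  .seq (.assign 13 (.const 1)) (.seq (.assign 14 (.const 0)) (.forN 8 0
    (.cond (.load 2 (.var 8))
      (.seq (.assign 14 (.add (.add (.add (.var 14) (.var 14)) (.var 14)) (.load 7 (.var 8))))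
        (.cond (.sub (.load 7 (.var 8)) (.const 2)) (.assign 13 (.const 0)) .skip))
      (.cond (.load 1 (.var 8))
        (.seq (.cond (.add (.sub (.load 7 (.var 8)) (.const 2)) (.sub (.const 2)
          (.load 7 (.var 8)))) (.assign 13 (.const 0)) .skip)
          (.cond (.load 9 (.load 8 (.var 8))) .skip (.assign 13 (.const 0)))) .skip))))

theorem check_spec {B n : ℕ} {a c d lab rep : ℕ → ℕ} {σ : State} (hn : σ.var 0 = n)
    (ha : σ.arr 1 = a) (hc : σ.arr 2 = c) (hd : σ.arr 7 = d) (hl : σ.arr 8 = lab)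
    (hr : σ.arr 9 = rep) (hdn : ∀ v < n, d v ≤ n) (hB : n * 3 ^ rk c n ≤ B) (hB1 : 1 ≤ B) :
    Tri B check σ (4 + n * 19) fun τ => τ.var 14 = key c d n ∧
      (τ.var 13 ≠ 0 ↔ ∀ v < n, (c v ≠ 0 → d v ≤ 2) ∧
        (c v = 0 → a v ≠ 0 → d v = 2 ∧ rep (lab v) ≠ 0)) := by
  refine Tri.le (Tri.seq (Tri.assign (by decide) (by simpa [Expr.eval]) (Tri.seq (Tri.assign
    (by decide) (by simp [Expr.eval]) (Tri.forN n (fun i τ => τ.var 14 = key c d i ∧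
      (τ.var 13 ≠ 0 ↔ ∀ v < i, (c v ≠ 0 → d v ≤ 2) ∧
        (c v = 0 → a v ≠ 0 → d v = 2 ∧ rep (lab v) ≠ 0))) (by decide) (by decide)
      (by simpa using hn) ?_ (T := (1 + (1 + 1 + 1)) + ((1 + 1 + 1) + (1 + 1 + 1) + 1 + 1) + 1)
      ?_ ?_))))) (by omega)
  · simp [Expr.eval, key]
  · rintro i hi τ hF h8 ⟨h14, h13⟩
    have ha' : τ.arr 1 = a := by rw [hF.2 1 (by decide)]; simpa using ha
    have hc' : τ.arr 2 = c := by rw [hF.2 2 (by decide)]; simpa using hc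
    have hd' : τ.arr 7 = d := by rw [hF.2 7 (by decide)]; simpa using hd
    have hl' : τ.arr 8 = lab := by rw [hF.2 8 (by decide)]; simpa using hl
    have hr' : τ.arr 9 = rep := by rw [hF.2 9 (by decide)]; simpa using hr
    have hsplit : ∀ p : ℕ → Prop, (∀ v < i + 1, p v) ↔ (∀ v < i, p v) ∧ p i := fun p =>
      ⟨fun h => ⟨fun v hv => h v (by omega), h i (by omega)⟩, fun h v hv => by
        rcases Nat.lt_succ_iff_lt_or_eq.1 hv with h' | rfl
        exacts [h.1 v h', h.2]⟩
    -- The flag may already be 0 while the number still grows, so only `d v ≤ n` is available to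
    -- bound it.
    have hk := key_add_le (c := c) (d := d) (N := n) (i + 1) fun v hv => hdn v (by omega)
    have hle := Nat.mul_le_mul_left n
      (Nat.pow_le_pow_right (by norm_num : 3 > 0) (rk_mono c (show i + 1 ≤ n from hi)))
    refine Tri.cond (T := 1 + (1 + 1 + 1)) (T' := (1 + 1 + 1) + (1 + 1 + 1) + 1 + 1) (by decide)
      (fun he => ?_) (fun he => Tri.cond (T := (1 + 1 + 1) + (1 + 1 + 1)) (T' := 1)
        (by decide) (fun he' => ?_) fun he' => Tri.skip ?_) <;> simp only [Expr.eval, h8, hc'] at he <;>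
      (try simp only [Expr.eval, h8, ha'] at he')
    · rw [key, if_neg he] at hk
      refine Tri.seq (T := 1) (T' := 1 + 1 + 1) ?_
      refine Tri.assign (by decide) (by simp [Expr.eval, h14, h8, hd']; omega) ?_
      refine Tri.cond (by decide) (fun h => Tri.assign (by decide) (by simp [Expr.eval]) ?_)
        (fun h => Tri.skip ?_) <;> simp [Expr.eval, h8, hd'] at h
      · refine ⟨by simp [Expr.eval, h14, h8, hd', key, he]; omega, ?_⟩
        rw [hsplit]
        simp [Expr.eval, he]
        intro _; omega
      · refine ⟨by simp [Expr.eval, h14, h8, hd', key, he]; omega, ?_⟩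
        rw [hsplit, ← h13]
        simp [he]; omega
    · have hki : key c d (i + 1) = key c d i := by rw [key, if_pos he]
      refine Tri.seq (T := 1 + 1 + 1) (T' := 1 + 1 + 1) ?_
      refine Tri.cond (by decide) (fun h => Tri.assign (by decide) (by simp [Expr.eval])
        ?_) (fun h => Tri.skip ?_) <;> simp only [Expr.eval, h8, hd'] at h
      · refine Tri.cond (by decide) (fun _ => Tri.skip ⟨by simp [h14, hki], ?_⟩)
          (fun _ => Tri.assign (by decide) (by simp [Expr.eval]) ⟨by simp [h14, hki], ?_⟩) <;>
        · rw [hsplit]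
          simp [Expr.eval, he, he']
          omega
      · refine Tri.cond (by decide) (fun h' => Tri.skip ⟨by simp [h14, hki], ?_⟩)
          (fun h' => Tri.assign (by decide) (by simp [Expr.eval]) ⟨by simp [h14, hki], ?_⟩) <;>
        simp [Expr.eval, h8, hl', hr'] at h'
        · rw [hsplit, ← h13]
          simp [he, he', h']; omega
        · rw [hsplit]
          simp [Expr.eval, he, he', h']
    · refine ⟨by simp [h14, key, he], ?_⟩
      rw [hsplit, ← h13]
      simp [he, he']
  · rintro τ - - h
    exact h

end Reduction

/-! ### The program: cut vectors, elimination and output -/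

namespace Reduction

open RAM

/-! ### Cut vectors -/

/-- Decode the colouring with number in variable `16`. -/
def decode : Prog :=
  .forN 8 0 (.cond (.load 2 (.var 8)) (.seq (.store 10 (.var 8) (.load 6 (.var 16)))
    (.assign 16 (.load 5 (.var 16)))) .skip)

/-- Variable 16 is halved at each separator vertex, so its parity is always the next binary digit of
`j`. -/
theorem decode_spec {B n N j : ℕ} {c : ℕ → ℕ} {σ : State} (hn : σ.var 0 = n) (hc : σ.arr 2 = c)
    (hj : σ.var 16 = j) (hjN : j < N) (hN : ∀ r < N, σ.arr 5 r = r / 2 ∧ σ.arr 6 r = r % 2) :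
    Tri B decode σ (2 + n * 7) fun τ => ∀ v < n, c v ≠ 0 → τ.arr 10 v = colour c j v := by
  refine Tri.forN n (fun i τ => τ.var 16 = j / 2 ^ rk c i ∧ ∀ v < i, c v ≠ 0 →
    τ.arr 10 v = colour c j v) (by decide) (by decide) hn (by simp [hj]) (T := 1 + 1 + 1 + 1) ?_
    fun _ _ _ h => h.2
  rintro i hi τ hF h8 ⟨h16, hI⟩
  have hc' : τ.arr 2 = c := by rw [hF.2 2 (by decide)]; simpa using hc
  have h5 : τ.arr 5 = σ.arr 5 := hF.2 5 (by decide)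
  have h6 : τ.arr 6 = σ.arr 6 := hF.2 6 (by decide)
  have hN' := hN (j / 2 ^ rk c i) ((Nat.div_le_self _ _).trans_lt hjN)
  refine Tri.of_bdd fun hb => Tri.cond (T := 1 + 1) (T' := 1) (by decide)
    (fun he => Tri.seq (Tri.store (by decide)
    (by decide) (hb.2 _ _) (Tri.assign (by decide) (hb.2 _ _) ⟨?_, ?_⟩)))
    (fun he => Tri.skip ⟨?_, ?_⟩) <;> simp only [Expr.eval, h8, hc'] at he
  · simp [Expr.eval, h16, h5, hN'.1, rk_succ, he, pow_succ, Nat.div_div_eq_div_mul]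
  · intro v hv hcv
    rcases Nat.lt_succ_iff_lt_or_eq.1 hv with h | rfl
    · simp [Expr.eval, h8, show v ≠ i by omega, hI v h hcv]
    · simp [Expr.eval, h8, h6, h16, hN'.2, colour]
  · simp [h16, rk_succ, he]
  · intro v hv hcv
    rcases Nat.lt_succ_iff_lt_or_eq.1 hv with h | rfl
    exacts [hI v h hcv, absurd he hcv]

/-- Test whether the decoded colouring is constant on the labels. -/
def compare : Prog :=
  .forN 8 0 (.cond (.load 2 (.var 8)) (.cond
    (.add (.sub (.load 10 (.var 8)) (.load 10 (.sub (.load 9 (.load 8 (.var 8))) (.const 1))))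
      (.sub (.load 10 (.sub (.load 9 (.load 8 (.var 8))) (.const 1))) (.load 10 (.var 8))))
    (.store 11 (.var 15) (.const 0)) .skip) .skip)

theorem compare_spec {B n j : ℕ} {c lab rep g : ℕ → ℕ} {σ : State} (hn : σ.var 0 = n)
    (hc : σ.arr 2 = c) (hj : σ.var 15 = j) (hl : σ.arr 8 = lab) (hr : σ.arr 9 = rep)
    (hg : σ.arr 10 = g) (h1 : σ.arr 11 j = 1) :
    Tri B compare σ (2 + n * 8) fun τ => (∀ i, i ≠ j → τ.arr 11 i = σ.arr 11 i) ∧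
      τ.arr 11 j ≤ 1 ∧ (τ.arr 11 j = 1 ↔ ∀ v < n, c v ≠ 0 → g v = g (rep (lab v) - 1)) := by
  refine Tri.forN n (fun k τ => (∀ i, i ≠ j → τ.arr 11 i = σ.arr 11 i) ∧ τ.arr 11 j ≤ 1 ∧
    (τ.arr 11 j = 1 ↔ ∀ v < k, c v ≠ 0 → g v = g (rep (lab v) - 1))) (by decide) (by decide) hn
    (by simp [h1]) (T := (1 + 1 + 1) + 1 + 1) ?_ fun _ _ _ h => h
  rintro i hi τ hF h8 ⟨hI, hI1, hI2⟩
  have hc' : τ.arr 2 = c := by rw [hF.2 2 (by decide)]; simpa using hc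
  have hj' : τ.var 15 = j := by rw [hF.1 15 (by decide)]; simpa using hj
  have hl' : τ.arr 8 = lab := by rw [hF.2 8 (by decide)]; simpa using hl
  have hr' : τ.arr 9 = rep := by rw [hF.2 9 (by decide)]; simpa using hr
  have hg' : τ.arr 10 = g := by rw [hF.2 10 (by decide)]; simpa using hg
  have hsplit : ∀ p : ℕ → Prop, (∀ v < i + 1, p v) ↔ (∀ v < i, p v) ∧ p i := fun p =>
    ⟨fun h => ⟨fun v hv => h v (by omega), h i (by omega)⟩, fun h v hv => by
      rcases Nat.lt_succ_iff_lt_or_eq.1 hv with h' | rfl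
      exacts [h.1 v h', h.2]⟩
  refine Tri.cond (T := 1 + 1 + 1) (T' := 1) (by decide) (fun he => Tri.cond (T := 1) (T' := 1)
    (by decide) (fun he' => Tri.store (by decide) (by decide) (by simp [Expr.eval]) ⟨?_, ?_, ?_⟩)
    (fun he' => Tri.skip ⟨hI, hI1, ?_⟩)) (fun he => Tri.skip ⟨hI, hI1, ?_⟩) <;>
    simp only [Expr.eval, h8, hc'] at he
  · intro x hx
    simp [Expr.eval, hj', hx, hI x hx]
  · simp [Expr.eval, hj']
  · simp only [Expr.eval, h8, hl', hr', hg'] at he'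
    rw [hsplit]
    simp [Expr.eval, hj', he]
    intro _; omega
  · simp only [Expr.eval, h8, hl', hr', hg'] at he'
    rw [hsplit, ← hI2]
    simp [he]; omega
  · rw [hsplit, ← hI2]
    simp [he]

/-- Compute the cut vector of the current edge set. -/
def cutVecs : Prog :=
  .forN 15 3 (.seq (.assign 16 (.var 15)) (.seq decode (.seq (.store 11 (.var 15) (.const 1))
    compare)))

/-- A colouring of the separator extends iff it is constant on separator vertices with a common
label, and comparing each of them with the representative of its label suffices. -/
theorem cutVec_eq {n : ℕ} {c lab rep : ℕ → ℕ} {E : ℕ → ℕ → Prop} (hlab : Labels n E lab)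
    (hr : ∀ x < n, rep x ≠ 0 → ∃ u < n, rep x = u + 1 ∧ c u ≠ 0 ∧ lab u = x)
    (hr' : ∀ u < n, c u ≠ 0 → rep (lab u) ≠ 0) (j : Fin (2 ^ rk c n))
    [Decidable (∀ v < n, c v ≠ 0 → colour c j v = colour c j (rep (lab v) - 1))] :
    cutVec n c E j = if ∀ v < n, c v ≠ 0 → colour c j v = colour c j (rep (lab v) - 1)
      then 1 else 0 := by
  classical
  unfold cutVec
  refine if_congr ⟨?_, fun H => ?_⟩ rfl rfl
  · rintro ⟨f, hf, hfc⟩ v hv hcv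
    obtain ⟨u, hu, hru, hcu, hlu⟩ := hr _ (hlab.lt v hv) (hr' v hv hcv)
    rw [hlab.respects_iff] at hf
    have h1 : (colour c j v : ZMod 2) = (colour c j u : ℕ) := by
      rw [← hfc v hv hcv, ← hfc u hu hcu, hf v hv, hf u hu, hlu]
    rw [hru, Nat.add_sub_cancel]
    have := (ZMod.natCast_eq_natCast_iff' _ _ 2).1 h1
    simpa [colour] using this
  -- For a label without a representative the truncated subtraction yields vertex 0; any value that
  -- depends only on the label is good enough there.
  · refine ⟨fun x => (colour c j (rep (lab x) - 1) : ℕ), ?_, fun v hv hcv => by rw [H v hv hcv]⟩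
    rw [hlab.respects_iff]
    intro x hx
    rw [hlab.idem x hx]

theorem cutVecs_spec {B n : ℕ} {c lab rep : ℕ → ℕ} {E : ℕ → ℕ → Prop} {σ : State}
    (hn : σ.var 0 = n) (hc : σ.arr 2 = c) (h3 : σ.var 3 = 2 ^ rk c n)
    (hN : ∀ r < 2 ^ rk c n, σ.arr 5 r = r / 2 ∧ σ.arr 6 r = r % 2)
    (hl : σ.arr 8 = lab) (hr : σ.arr 9 = rep) (hlab : Labels n E lab)
    (hr1 : ∀ x < n, rep x ≠ 0 → ∃ u < n, rep x = u + 1 ∧ c u ≠ 0 ∧ lab u = x)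
    (hr2 : ∀ u < n, c u ≠ 0 → rep (lab u) ≠ 0) (hB : 1 ≤ B) :
    Tri B cutVecs σ (2 + 2 ^ rk c n * (9 + n * 15)) fun τ =>
      (∀ j < 2 ^ rk c n, τ.arr 11 j ≤ 1) ∧ toVec (2 ^ rk c n) (τ.arr 11) = cutVec n c E := by
  refine Tri.le (Tri.forN (2 ^ rk c n) (fun i τ => ∀ j < i, τ.arr 11 j ≤ 1 ∧ (τ.arr 11 j = 1 ↔
    ∀ v < n, c v ≠ 0 → colour c j v = colour c j (rep (lab v) - 1))) (by decide) (by decide) h3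
    (by simp) (T := 1 + (2 + n * 7 + (1 + (2 + n * 8)))) ?_ ?_) (le_of_eq (by ring))
  · rintro j hj τ hF h15 hI
    have hn' : τ.var 0 = n := by rw [hF.1 0 (by decide)]; simpa using hn
    have hc' : τ.arr 2 = c := by rw [hF.2 2 (by decide)]; simpa using hc
    have hl' : τ.arr 8 = lab := by rw [hF.2 8 (by decide)]; simpa using hl
    have hr' : τ.arr 9 = rep := by rw [hF.2 9 (by decide)]; simpa using hr
    refine Tri.of_bdd fun hb => Tri.seq (Tri.assign (by decide) (hb.1 _) (Tri.seq (Tri.framed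
      (decode_spec (N := 2 ^ rk c n) (j := j) (by simpa using hn') (by simpa using hc')
      (by simp [Expr.eval, h15]) hj ?_) ?_)))
    · simpa [hF.2 5 (by decide), hF.2 6 (by decide)] using hN
    intro υ hυ hg
    have h15' : υ.var 15 = j := by rw [hυ.1 15 (by decide)]; simpa using h15
    have hc'' : υ.arr 2 = c := by rw [hυ.2 2 (by decide)]; simpa using hc'
    have h11 : υ.arr 11 = τ.arr 11 := by rw [hυ.2 11 (by decide)]; simp
    refine Tri.seq (Tri.store (by decide) (by decide) (by simpa [Expr.eval]) (Tri.framed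
      (compare_spec (c := c) (lab := lab) (rep := rep) (j := j) (g := υ.arr 10) ?_ ?_ ?_ ?_ ?_
      (by simp) (by simp [Expr.eval, h15'])) ?_))
    · simpa [hυ.1 0 (by decide)] using hn'
    · simpa using hc''
    · simpa using h15'
    · simpa [hυ.2 8 (by decide)] using hl'
    · simpa [hυ.2 9 (by decide)] using hr'
    · rintro ω hω ⟨h1, h2, h3⟩
      intro i hi
      rcases Nat.lt_succ_iff_lt_or_eq.1 hi with h | rfl
      · have := h1 i (by omega)
        simp only [State.arr_setArr, Expr.eval, h15', Function.update_apply, reduceIte,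
          show i ≠ j by omega, h11] at this
        simpa [this] using hI i h
      · refine ⟨h2, h3.trans (forall₃_congr fun v hv hcv => ?_)⟩
        obtain ⟨u, hu, hru, hcu, hlu⟩ := hr1 _ (hlab.lt v hv) (hr2 v hv hcv)
        rw [hg v hv hcv, hru, Nat.add_sub_cancel, hg u hu hcu]
  · rintro τ - - h
    refine ⟨fun j hj => (h j hj).1, ?_⟩
    classical
    funext j
    rw [cutVec_eq hlab hr1 hr2]
    obtain ⟨h1, h2⟩ := h j j.2
    rw [← if_congr h2 rfl rfl]
    simp only [toVec]
    split_ifs with h3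
    · simp [h3]
    · simp [show τ.arr 11 j = 0 by omega]

/-! ### Gaussian elimination over `ZMod 2` -/

/-- Add a stored row to the working vector. -/
def addRow : Prog :=
  .forN 21 3 (.cond (.load 13 (.add (.var 11) (.var 21)))
    (.store 11 (.var 21) (.sub (.const 1) (.load 11 (.var 21)))) .skip)

theorem addRow_spec {B N b : ℕ} {w rows : ℕ → ℕ} {σ : State} (hN : σ.var 3 = N)
    (hb : σ.var 11 = b) (hw : σ.arr 11 = w) (hr : σ.arr 13 = rows) (hB : 1 ≤ B) :
    Tri B addRow σ (2 + N * 6) fun τ => ∀ j < N, τ.arr 11 j =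
      if rows (b + j) = 0 then w j else 1 - w j := by
  refine Tri.forN N (fun i τ => ∀ j, τ.arr 11 j =
    if j < i ∧ rows (b + j) ≠ 0 then 1 - w j else w j) (by decide) (by decide) hN (by simp [hw])
    (T := 1 + 1 + 1) ?_ ?_
  · rintro i hi τ hF h21 hI
    have hb' : τ.var 11 = b := by rw [hF.1 11 (by decide)]; simpa using hb
    have hr' : τ.arr 13 = rows := by rw [hF.2 13 (by decide)]; simpa using hr
    have hi' := hI i
    rw [if_neg (by omega)] at hi'
    refine Tri.cond (by decide) (fun he => Tri.store (by decide) (by decide)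
      (by simp [Expr.eval]; omega) ?_) (fun he => Tri.skip ?_) <;>
      simp only [Expr.eval, hb', h21, hr'] at he <;> intro j <;>
      simp only [Expr.eval, State.arr_setVar, State.arr_setArr, h21, reduceIte,
        Function.update_apply, hi', hI j]
    · by_cases hj : j = i
      · subst hj; simp [he]
      · simp only [hj, if_false, show j < i + 1 ↔ j < i by omega]
    · by_cases hj : j = i
      · subst hj; simp [he]
      · simp only [show j < i + 1 ↔ j < i by omega]
  · intro τ _ _ h j hj
    simp [h j, hj]

/-- Store the working vector as a new row and clear it. -/
def newRow : Prog :=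
  .forN 21 3 (.seq (.store 13 (.var 18) (.load 11 (.var 21)))
    (.seq (.store 11 (.var 21) (.const 0)) (.assign 18 (.add (.var 18) (.const 1)))))

/-- Clearing the working vector makes the remaining rounds of the elimination idle, so one edge set
yields at most one row. -/
theorem newRow_spec {B N top : ℕ} {w rows : ℕ → ℕ} {σ : State} (hN : σ.var 3 = N)
    (ht : σ.var 18 = top) (hw : σ.arr 11 = w) (hr : σ.arr 13 = rows) (hB : top + N ≤ B) :
    Tri B newRow σ (2 + N * 6) fun τ => τ.var 18 = top + N ∧ (∀ j < top, τ.arr 13 j = rows j) ∧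
      (∀ j < N, τ.arr 13 (top + j) = w j) ∧ ∀ j < N, τ.arr 11 j = 0 := by
  refine Tri.forN N (fun i τ => τ.var 18 = top + i ∧ (∀ j < top, τ.arr 13 j = rows j) ∧
    (∀ j < i, τ.arr 13 (top + j) = w j) ∧ ∀ j, τ.arr 11 j = if j < i then 0 else w j)
    (by decide) (by decide) hN (by simp [hw, hr, ht]) (T := 1 + (1 + 1)) ?_ ?_
  · rintro i hi τ hF h21 ⟨h18, h1, h2, h3⟩
    refine Tri.of_bdd fun hb => Tri.seq (Tri.store (by decide) (by decide) (hb.2 _ _) (Tri.seq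
      (Tri.store (by decide) (by decide) (by simp [Expr.eval]) (Tri.assign (by decide)
      (by simp [Expr.eval, h18]; omega) ?_))))
    simp only [Expr.eval, State.var_setVar, State.arr_setVar, State.arr_setArr, State.var_setArr,
      h21, h18, reduceIte, Nat.reduceEqDiff, Function.update_apply]
    refine ⟨by omega, fun j hj => ?_, fun j hj => ?_, fun j => ?_⟩
    · rw [if_neg (by omega), h1 j hj]
    · by_cases hji : j = i
      · subst hji; simp [h3]
      · rw [if_neg (by omega), h2 j (by omega)]
    · by_cases hji : j = i
      · subst hji; simp
      · simp only [hji, if_false, h3, show j < i + 1 ↔ j < i by omega]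
  · rintro τ - - ⟨h1, h2, h3, h4⟩
    exact ⟨h1, h2, h3, fun j hj => by simp [h4 j, hj]⟩

/-- Process one entry of the working vector. -/
def pivot : Prog :=
  .cond (.load 11 (.var 15)) (.seq (.assign 11 (.load 12 (.var 17))) (.cond (.var 11) addRow
    (.seq (.store 12 (.var 17) (.var 18)) (.seq newRow (.assign 19 (.const 1)))))) .skip

/-- Reduce the working vector by the echelon basis, and extend the basis if it does not vanish. -/
def reduce : Prog :=
  .seq (.assign 17 (.var 14)) (.forN 15 3 (.seq pivot (.assign 17 (.add (.var 17) (.var 4)))))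

/-- As long as no row has been stored, the working vector differs from `w` by an element of `U D`
and vanishes before entry `f`. A pivot row for `f` has zeros before `f`, so adding it clears entry
`f` and spoils nothing; if there is none, the working vector itself becomes this row. -/
theorem reduce_spec {B N M D top : ℕ} {U U' : ℕ → Submodule (ZMod 2) (Fin N → ZMod 2)}
    {ptr rows w : ℕ → ℕ} {σ : State} (hN : σ.var 3 = N) (hM : σ.var 4 = M) (hD : σ.var 14 = D)
    (ht : σ.var 18 = top) (h19 : σ.var 19 = 0) (hw : σ.arr 11 = w) (hp : σ.arr 12 = ptr)
    (hr : σ.arr 13 = rows) (hP : Pivots N M U ptr rows top) (hU : ∀ D, U D ≤ U' D)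
    (hDM : D < M) (hw1 : ∀ j < N, w j ≤ 1) (hwU : toVec N w ∈ U' D) (hB : top + N ≤ B)
    (hB' : D + N * M ≤ B) :
    Tri B reduce σ (3 + N * (14 + N * 12)) fun τ =>
      (τ.var 19 = 0 ∧ τ.var 18 = top ∧ τ.arr 12 = ptr ∧ τ.arr 13 = rows ∧ toVec N w ∈ U D) ∨
      (τ.var 19 = 1 ∧ τ.var 18 = top + N ∧ Pivots N M U' (τ.arr 12) (τ.arr 13) (top + N) ∧
        pivotCount (N * M) (τ.arr 12) = pivotCount (N * M) ptr + 1) := by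
  have hB1 : 1 ≤ B := by have := hP.pos; omega
  refine Tri.le (Tri.seq (Tri.of_bdd fun hb => Tri.assign (by decide) (hb.1 _) (Tri.forN N
    (fun f τ => τ.var 17 = D + f * M ∧ (∀ j < N, τ.arr 11 j ≤ 1) ∧
      (∀ j < N, j < f → τ.arr 11 j = 0) ∧
      ((τ.var 19 = 0 ∧ τ.var 18 = top ∧ τ.arr 12 = ptr ∧ τ.arr 13 = rows ∧
        toVec N w - toVec N (τ.arr 11) ∈ U D) ∨
      (τ.var 19 = 1 ∧ τ.var 18 = top + N ∧ Pivots N M U' (τ.arr 12) (τ.arr 13) (top + N) ∧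
        pivotCount (N * M) (τ.arr 12) = pivotCount (N * M) ptr + 1 ∧ ∀ j < N, τ.arr 11 j = 0)))
    (by decide) (by decide) (by simpa using hN) ?_
    (T := (1 + ((2 + N * 6) + (1 + (2 + N * 6 + 1)) + 1) + 1 + 1) + 1) ?_ ?_)))
    (T := 1 + (2 + N * ((1 + ((2 + N * 6) + (1 + (2 + N * 6 + 1)) + 1) + 1 + 1) + 1 + 3)))
    (le_of_eq (by ring))
  · refine ⟨by simp [Expr.eval, hD], by simpa [hw] using hw1, by simp, Or.inl ?_⟩
    simp [h19, ht, hp, hr, hw]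
  · rintro f hf τ hF h15 ⟨h17, hτ1, hτ0, hτ⟩
    have hN' : τ.var 3 = N := by rw [hF.1 3 (by decide)]; simpa using hN
    have hM' : τ.var 4 = M := by rw [hF.1 4 (by decide)]; simpa using hM
    have hfM : f * M + M ≤ N * M := by nlinarith
    refine Tri.seq (Tri.le (T := 1 + ((2 + N * 6) + (1 + (2 + N * 6 + 1)) + 1) + 1 + 1)
      (Tri.framed (Q := fun υ => (∀ j < N, υ.arr 11 j ≤ 1) ∧
        (∀ j < N, j < f + 1 → υ.arr 11 j = 0) ∧
        ((υ.var 19 = 0 ∧ υ.var 18 = top ∧ υ.arr 12 = ptr ∧ υ.arr 13 = rows ∧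
          toVec N w - toVec N (υ.arr 11) ∈ U D) ∨
        (υ.var 19 = 1 ∧ υ.var 18 = top + N ∧ Pivots N M U' (υ.arr 12) (υ.arr 13) (top + N) ∧
          pivotCount (N * M) (υ.arr 12) = pivotCount (N * M) ptr + 1 ∧
          ∀ j < N, υ.arr 11 j = 0))) ?_ ?_) le_rfl)
    · refine Tri.of_bdd fun hb => Tri.cond (T := 1 + ((2 + N * 6) + (1 + (2 + N * 6 + 1)) + 1))
        (T' := 1) (by decide) (fun he => ?_) (fun he => Tri.skip ?_) <;>
        simp only [Expr.eval, h15] at he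
      · rcases hτ with ⟨h19', h18', h12', h13', hmem⟩ | ⟨-, -, -, -, hz⟩
        swap
        · exact absurd (hz f hf) he
        have hτf : τ.arr 11 f = 1 := by have := hτ1 f hf; omega
        refine Tri.seq (Tri.assign (by decide) (hb.2 _ _) (Tri.cond (T := 2 + N * 6)
          (T' := 1 + (2 + N * 6 + 1)) (by decide) (fun hne => Tri.framed
            (addRow_spec (by simpa using hN') rfl rfl rfl hB1) fun υ hυ hadd => ?_)
            (fun h0 => ?_)))
        · simp only [Expr.eval, h17, h12', State.var_setVar, State.arr_setVar, if_true, h13']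
            at hne hadd
          have hle := hP.le_one D hDM f hf hne
          refine ⟨fun j hj => ?_, fun j hj hjf => ?_, Or.inl ⟨?_, ?_, ?_, ?_, ?_⟩⟩
          · have := hτ1 j hj
            rw [hadd j hj]; split_ifs <;> omega
          · rw [hadd j hj]
            rcases Nat.lt_succ_iff_lt_or_eq.1 hjf with h | rfl
            · rw [hP.zero D hDM f hf hne j h, if_pos rfl, hτ0 j hj h]
            · rw [hP.lead D hDM j hf hne, if_neg one_ne_zero, hτf]
          · rw [hυ.1 19 (by decide)]; simpa using h19'
          · rw [hυ.1 18 (by decide)]; simpa using h18'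
          · rw [hυ.2 12 (by decide)]; simpa using h12'
          · rw [hυ.2 13 (by decide)]; simpa using h13'
          · have : toVec N (υ.arr 11) = toVec N (τ.arr 11) +
                toVec N (fun j => rows (ptr (D + f * M) + j)) := by
              funext j
              simp only [toVec, Pi.add_apply, hadd j j.2]
              have h1 := hle j j.2
              have h2 := hτ1 j j.2
              interval_cases rows (ptr (D + f * M) + j) <;> interval_cases τ.arr 11 j <;> decide
            rw [this, ← sub_sub]
            exact Submodule.sub_mem _ hmem (hP.mem D hDM f hf hne)
        · simp only [Expr.eval, h17, h12', State.var_setVar, if_true] at h0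
          refine Tri.seq (T := 1) (Tri.of_bdd fun hb => Tri.store (by decide) (by decide) (hb.1 _)
            (Tri.seq (Tri.framed (newRow_spec (by simpa using hN') (by simpa using h18')
              rfl rfl hB) ?_)))
          rintro υ hυ ⟨k18, k13, k13', k11⟩
          refine Tri.assign (by decide) (by simpa [Expr.eval]) ?_
          have h12 : υ.arr 12 = Function.update ptr (D + f * M) top := by
            rw [hυ.2 12 (by decide)]
            simp [Expr.eval, h17, h12', h18']
          simp [h13'] at k13 k13'
          simp only [State.arr_setVar, State.var_setVar, Expr.eval, reduceIte, Nat.reduceEqDiff]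
          refine ⟨fun j hj => by rw [k11 j hj]; omega, fun j hj _ => k11 j hj,
            Or.inr ⟨trivial, k18, ?_, ?_, k11⟩⟩
          · rw [h12]
            refine hP.insert hU hDM hτ1 hτf (fun j hj => hτ0 j (by omega) hj) ?_ hf k13 k13'
            -- The remainder is `w` minus an element of `U D`.
            have := Submodule.sub_mem _ hwU (hU D hmem)
            simpa using this
          · rw [h12]
            exact pivotCount_update (by omega) h0 hP.pos.ne'
      · refine ⟨hτ1, fun j hj hjf => ?_, hτ⟩
        rcases Nat.lt_succ_iff_lt_or_eq.1 hjf with h | rfl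
        exacts [hτ0 j hj h, he]
    · rintro υ hυ ⟨k1, k2, k3⟩
      have k17 : υ.var 17 = D + f * M := by rw [hυ.1 17 (by decide)]; exact h17
      have k4 : υ.var 4 = M := by rw [hυ.1 4 (by decide)]; exact hM'
      refine Tri.assign (by decide) (by simp [Expr.eval, k17, k4]; omega) ?_
      simp only [State.arr_setVar, State.var_setVar, Expr.eval, reduceIte, Nat.reduceEqDiff, k17,
        k4]
      exact ⟨by ring, k1, k2, k3⟩
  · rintro τ - - ⟨-, -, h0, ⟨h1, h2, h3, h4, h5⟩ | ⟨h1, h2, h3, h4, -⟩⟩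
    · refine Or.inl ⟨h1, h2, h3, h4, ?_⟩
      -- Every entry has been cleared, so the difference that lies in `U D` is `w` itself.
      have : toVec N (τ.arr 11) = 0 := by
        funext j
        simp [toVec, h0 j j.2 j.2]
      simpa [this] using h5
    · exact Or.inr ⟨h1, h2, h3, h4⟩

/-! ### Output -/

/-- Copy the current edge set to the output. -/
def copy : Prog :=
  .forN 8 0 (.forN 9 0 (.seq (.store 4 (.var 20) (.load 3 (.var 5)))
    (.seq (.assign 20 (.add (.var 20) (.const 1))) (.assign 5 (.add (.var 5) (.const 1))))))

theorem copy_spec {B n b o : ℕ} {W out : ℕ → ℕ} {σ : State} (hn : σ.var 0 = n)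
    (hb : σ.var 5 = b) (ho : σ.var 20 = o) (hW : σ.arr 3 = W) (hout : σ.arr 4 = out)
    (hB : b + n * n ≤ B) (hB' : o + n * n ≤ B) :
    Tri B copy σ (2 + n * (5 + n * 6)) fun τ => τ.var 20 = o + n * n ∧ τ.var 5 = b + n * n ∧
      (∀ j < o, τ.arr 4 j = out j) ∧ ∀ j < n * n, τ.arr 4 (o + j) = W (b + j) := by
  set J : ℕ → State → Prop := fun t τ => τ.var 20 = o + t ∧ τ.var 5 = b + t ∧
    (∀ j < o, τ.arr 4 j = out j) ∧ ∀ j < t, τ.arr 4 (o + j) = W (b + j) with hJ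
  refine Tri.le (Tri.forN n (fun u => J (u * n)) (by decide) (by decide) hn ?_
    (T := 2 + n * (1 + (1 + 1) + 3)) ?_ fun _ _ _ h => h) (le_of_eq (by ring))
  · simp [hJ, ho, hb, hout]
  · rintro u hu τ hF h8 hI
    have hn' : τ.var 0 = n := by rw [hF.1 0 (by decide)]; simpa using hn
    have hW' : τ.arr 3 = W := by rw [hF.2 3 (by decide)]; simpa using hW
    refine Tri.forN n (fun v => J (u * n + v)) (by decide) (by decide) hn' hI ?_ ?_
    · rintro v hv υ hF' h9 ⟨h20, h5, h1, h2⟩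
      have hW'' : υ.arr 3 = W := by rw [hF'.2 3 (by decide)]; simpa using hW'
      have hp : u * n + v + 1 ≤ n * n := by nlinarith
      refine Tri.of_bdd fun hb => Tri.seq (Tri.store (by decide) (by decide) (hb.2 _ _) (Tri.seq
        (Tri.assign (by decide) (by simp [Expr.eval, h20]; omega) (Tri.assign (by decide)
          (by simp [Expr.eval, h5]; omega) ?_))))
      simp only [hJ, Expr.eval, State.var_setVar, State.arr_setVar, State.arr_setArr,
        State.var_setArr, h20, h5, reduceIte, Nat.reduceEqDiff, Function.update_apply, hW'']
      refine ⟨by omega, by omega, fun j hj => ?_, fun j hj => ?_⟩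
      · rw [if_neg (by omega), h1 j hj]
      · by_cases hj' : j = u * n + v
        · simp [hj']
        · rw [if_neg (by omega), h2 j (by omega)]
    · rintro υ - - h
      have e : (u + 1) * n = u * n + n := by ring
      simp only [e]
      exact h

/-- Output the current edge set if it is to be kept, and move on. -/
def emit : Prog :=
  .cond (.var 19) (.seq copy (.assign 2 (.add (.var 2) (.const 1)))) (.assign 5 (.var 6))

/-- Copying moves the read position in variable 5 past the edge set; otherwise it jumps to the end
that the scan left in variable 6. -/
theorem emit_spec {B n b o k : ℕ} {W out : ℕ → ℕ} {σ : State} (hn : σ.var 0 = n)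
    (hb : σ.var 5 = b) (h6 : σ.var 6 = b + n * n) (ho : σ.var 20 = o) (hk : σ.var 2 = k)
    (hW : σ.arr 3 = W) (hout : σ.arr 4 = out)
    (hB : b + n * n ≤ B) (hB' : o + n * n ≤ B) (hBk : k + 1 ≤ B) :
    Tri B emit σ (5 + n * (5 + n * 6)) fun τ => τ.var 5 = b + n * n ∧
      (σ.var 19 = 0 → τ.var 2 = k ∧ τ.var 20 = o ∧ τ.arr 4 = out) ∧
      (σ.var 19 ≠ 0 → τ.var 2 = k + 1 ∧ τ.var 20 = o + n * n ∧
      (∀ j < o, τ.arr 4 j = out j) ∧ ∀ j < n * n, τ.arr 4 (o + j) = W (b + j)) := by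
  refine Tri.le (Tri.cond (T := 2 + n * (5 + n * 6) + 1) (T' := 1) (by decide) (fun he => Tri.seq
    (Tri.framed (copy_spec hn hb ho hW hout hB hB') ?_)) (fun he => Tri.of_bdd fun hbd =>
      Tri.assign (by decide) (hbd.1 _) ?_)) (by omega)
  · rintro τ hF ⟨h1, h2, h3, h4⟩
    have h2' : τ.var 2 = k := by rw [hF.1 2 (by decide)]; exact hk
    refine Tri.assign (by decide) (by simpa [Expr.eval, h2']) ?_
    refine ⟨by simpa using h2, fun h => absurd h he, fun _ => ⟨by simp [Expr.eval, h2'],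
      by simpa using h1, h3, h4⟩⟩
  · exact ⟨by simp [Expr.eval, h6], fun _ => ⟨by simpa using hk, by simpa using ho,
      by simpa using hout⟩, fun h => absurd he h⟩

end Reduction

/-! ### The program: the main loop -/

namespace Reduction

open RAM

/-- The analysis of the current edge set. -/
def analyse : Prog := .seq reset (.seq scan (.seq hits check))

theorem valid_iff {n : ℕ} {a c lab rep : ℕ → ℕ} {E : ℕ → ℕ → Prop} (hlab : Labels n E lab)
    (hr : ∀ x < n, rep x ≠ 0 → ∃ u < n, rep x = u + 1 ∧ c u ≠ 0 ∧ lab u = x)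
    (hr' : ∀ u < n, c u ≠ 0 → rep (lab u) ≠ 0) :
    Valid n a c E ↔ ∀ v < n, (c v ≠ 0 → degN n E v ≤ 2) ∧
      (c v = 0 → a v ≠ 0 → degN n E v = 2 ∧ rep (lab v) ≠ 0) := by
  refine forall₂_congr fun v hv => and_congr_right fun _ => forall₂_congr fun _ _ =>
    and_congr_right fun _ => ⟨?_, fun h => ?_⟩
  · rintro ⟨u, hu, hcu, hf⟩
    have : lab u = lab v := by
      -- The indicator of the label class of `v` separates it from every vertex with another label.
      have := hf (fun x => if lab x = lab v then 1 else 0) <| by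
        rw [hlab.respects_iff]
        intro x hx
        rw [hlab.idem x hx]
      by_contra hne
      simp [hne] at this
    rw [← this]
    exact hr' u hu hcu
  · obtain ⟨u, hu, -, hcu, hlu⟩ := hr _ (hlab.lt v hv) h
    refine ⟨u, hu, hcu, fun f hf => ?_⟩
    rw [hlab.respects_iff] at hf
    rw [hf u hu, hf v hv, hlu]

theorem analyse_spec {B n b : ℕ} {a c W : ℕ → ℕ} {σ : State} (hn : σ.var 0 = n)
    (hb : σ.var 5 = b) (ha : σ.arr 1 = a) (hc : σ.arr 2 = c) (hW : σ.arr 3 = W)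
    (hB : b + n * n ≤ B) (hB' : n * 3 ^ rk c n ≤ B) (hB1 : 1 ≤ B) :
    Tri B analyse σ (11 + n * (36 + n * (11 + n * 6))) fun τ => τ.var 6 = b + n * n ∧
      τ.var 14 = degKey n c (EdgeAt W n b) ∧ (τ.var 13 ≠ 0 ↔ Valid n a c (EdgeAt W n b)) ∧
      Labels n (EdgeAt W n b) (τ.arr 8) ∧
      (∀ x < n, τ.arr 9 x ≠ 0 → ∃ u < n, τ.arr 9 x = u + 1 ∧ c u ≠ 0 ∧ τ.arr 8 u = x) ∧
      ∀ u < n, c u ≠ 0 → τ.arr 9 (τ.arr 8 u) ≠ 0 := by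
  have hnB : n ≤ B := le_trans (Nat.le_mul_of_pos_right _ (by positivity)) hB'
  refine Tri.le (Tri.seq (Tri.framed (reset_spec hn) ?_))
    (T := (2 + n * 6) + (3 + n * (5 + n * (11 + n * 6)) + ((2 + n * 6) + (4 + n * 19))))
    (le_of_eq (by ring))
  intro τ hF hτ
  have hn' : τ.var 0 = n := by rw [hF.1 0 (by decide)]; exact hn
  refine Tri.seq (Tri.framed (scan_spec hn' ((hF.1 5 (by decide)).trans hb)
    ((hF.2 3 (by decide)).trans hW) (fun x hx => (hτ x hx).1) (fun x hx => (hτ x hx).2.1) hB hnB) ?_)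
  rintro υ hF' ⟨h6, h7, h8⟩
  have hn'' : υ.var 0 = n := by rw [hF'.1 0 (by decide)]; exact hn'
  have h9 : υ.arr 9 = τ.arr 9 := hF'.2 9 (by decide)
  have hc' : υ.arr 2 = c := by rw [hF'.2 2 (by decide), hF.2 2 (by decide)]; exact hc
  have ha' : υ.arr 1 = a := by rw [hF'.2 1 (by decide), hF.2 1 (by decide)]; exact ha
  refine Tri.seq (Tri.framed (hits_spec hn'' hc' rfl
    (fun x hx => by rw [h9]; exact (hτ x hx).2.2) hnB) ?_)
  rintro ω hF'' ⟨h1, h2⟩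
  have k7 : ω.arr 7 = υ.arr 7 := hF''.2 7 (by decide)
  have k8 : ω.arr 8 = υ.arr 8 := hF''.2 8 (by decide)
  have kc : ω.arr 2 = c := (hF''.2 2 (by decide)).trans hc'
  refine Tri.framed (check_spec (n := n) (a := a) (c := c) (d := υ.arr 7) (lab := υ.arr 8)
    (rep := ω.arr 9) ((hF''.1 0 (by decide)).trans hn'') ((hF''.2 1 (by decide)).trans ha') kc k7 k8
    rfl (fun v hv => by rw [h7 v hv]; exact degN_le _ _ _) hB' hB1) ?_
  rintro χ hF3 ⟨k14, k13⟩
  have l8 : χ.arr 8 = υ.arr 8 := by rw [hF3.2 8 (by decide), k8]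
  have l9 : χ.arr 9 = ω.arr 9 := hF3.2 9 (by decide)
  rw [l8, l9]
  refine ⟨?_, k14.trans (key_congr n h7), k13.trans ?_, h8, h1, h2⟩
  · rw [hF3.1 6 (by decide), hF''.1 6 (by decide), h6]
  · rw [valid_iff h8 h1 h2]
    refine forall₂_congr fun v hv => ?_
    rw [h7 v hv]

/-- The span of the cut vectors of the listed edge sets with degree sequence number `D`. -/
def spanOf (n : ℕ) (c W : ℕ → ℕ) (O : List ℕ) (D : ℕ) :
    Submodule (ZMod 2) (Fin (2 ^ rk c n) → ZMod 2) :=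
  Submodule.span (ZMod 2) {x | ∃ k ∈ O, degKey n c (EdgeAt W n (k * (n * n))) = D ∧
    cutVec n c (EdgeAt W n (k * (n * n))) = x}

theorem spanOf_mono {n : ℕ} {c W : ℕ → ℕ} {O O' : List ℕ} (h : O ⊆ O') (D : ℕ) :
    spanOf n c W O D ≤ spanOf n c W O' D :=
  Submodule.span_mono fun _ ⟨k, hk, h'⟩ => ⟨k, h hk, h'⟩

/-- Reduce the cut vector of the current edge set if this set is valid. -/
def eliminate : Prog := .cond (.var 13) (.seq cutVecs reduce) .skip

/-- Process one edge set. -/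
def step : Prog := .seq analyse (.seq (.assign 19 (.const 0)) (.seq eliminate emit))

/-- The number of operations for one edge set on `n` vertices with vectors of length `N`. -/
def stepTime (n N : ℕ) : ℕ :=
  (11 + n * (36 + n * (11 + n * 6))) + (1 + ((2 + N * (9 + n * 15)) + (3 + N * (14 + N * 12)) + 1 +
    1 + (5 + n * (5 + n * 6))))

/-- The edge sets with numbers in `O` represent the first `i` edge sets. -/
structure Represents (n : ℕ) (a c W : ℕ → ℕ) (i : ℕ) (O : List ℕ) : Prop where
  sublist : O.Sublist (List.range i)
  valid : ∀ k ∈ O, Valid n a c (EdgeAt W n (k * (n * n)))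
  mem : ∀ k < i, Valid n a c (EdgeAt W n (k * (n * n))) → cutVec n c (EdgeAt W n (k * (n * n))) ∈
    spanOf n c W O (degKey n c (EdgeAt W n (k * (n * n))))

/-- The memory `σ` holds the list `O` of numbers of edge sets as output. -/
def Holds (n : ℕ) (W : ℕ → ℕ) (O : List ℕ) (σ : State) : Prop :=
  σ.var 2 = O.length ∧ ∀ (t : ℕ) (ht : t < O.length), ∀ j < n * n,
    σ.arr 4 (t * (n * n) + j) = W (O[t] * (n * n) + j)

/-- The invariant of the main loop. -/
def MainInv (n : ℕ) (a c W : ℕ → ℕ) (i : ℕ) (σ : State) : Prop :=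
  ∃ O : List ℕ, Represents n a c W i O ∧ Holds n W O σ ∧ σ.var 20 = O.length * (n * n) ∧
    σ.var 5 = i * (n * n) ∧ σ.var 18 = 1 + O.length * 2 ^ rk c n ∧
    pivotCount (2 ^ rk c n * 3 ^ rk c n) (σ.arr 12) = O.length ∧
    Pivots (2 ^ rk c n) (3 ^ rk c n) (spanOf n c W O) (σ.arr 12) (σ.arr 13) (σ.var 18)

theorem degKey_lt {n : ℕ} {a c : ℕ → ℕ} {E : ℕ → ℕ → Prop} (h : Valid n a c E) :
    degKey n c E < 3 ^ rk c n :=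
  key_lt n fun v hv => (h v hv).1

theorem eliminate_spec {B n i top : ℕ} {O : List ℕ} {a c W ptr rows : ℕ → ℕ} {σ : State}
    (hn : σ.var 0 = n) (h3 : σ.var 3 = 2 ^ rk c n) (h4 : σ.var 4 = 3 ^ rk c n) (hc : σ.arr 2 = c)
    (hN : ∀ r < 2 ^ rk c n, σ.arr 5 r = r / 2 ∧ σ.arr 6 r = r % 2) (h18 : σ.var 18 = top)
    (h19 : σ.var 19 = 0) (hp : σ.arr 12 = ptr) (hr : σ.arr 13 = rows)
    (h14 : σ.var 14 = degKey n c (EdgeAt W n (i * (n * n))))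
    (h13 : σ.var 13 ≠ 0 ↔ Valid n a c (EdgeAt W n (i * (n * n))))
    (hlab : Labels n (EdgeAt W n (i * (n * n))) (σ.arr 8))
    (hr1 : ∀ x < n, σ.arr 9 x ≠ 0 → ∃ u < n, σ.arr 9 x = u + 1 ∧ c u ≠ 0 ∧ σ.arr 8 u = x)
    (hr2 : ∀ u < n, c u ≠ 0 → σ.arr 9 (σ.arr 8 u) ≠ 0)
    (hP : Pivots (2 ^ rk c n) (3 ^ rk c n) (spanOf n c W O) ptr rows top)
    (hB : top + 2 ^ rk c n ≤ B) (hB4 : 3 ^ rk c n + 2 ^ rk c n * 3 ^ rk c n ≤ B) :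
    Tri B eliminate σ ((2 + 2 ^ rk c n * (9 + n * 15)) +
      (3 + 2 ^ rk c n * (14 + 2 ^ rk c n * 12)) + 1 + 1) fun τ =>
      (τ.var 19 = 0 ∧ τ.var 18 = top ∧ τ.arr 12 = ptr ∧ τ.arr 13 = rows ∧
        (Valid n a c (EdgeAt W n (i * (n * n))) → cutVec n c (EdgeAt W n (i * (n * n))) ∈
          spanOf n c W O (degKey n c (EdgeAt W n (i * (n * n)))))) ∨
      (τ.var 19 = 1 ∧ τ.var 18 = top + 2 ^ rk c n ∧ Valid n a c (EdgeAt W n (i * (n * n))) ∧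
        Pivots (2 ^ rk c n) (3 ^ rk c n) (spanOf n c W (O ++ [i])) (τ.arr 12) (τ.arr 13)
          (top + 2 ^ rk c n) ∧
        pivotCount (2 ^ rk c n * 3 ^ rk c n) (τ.arr 12) =
          pivotCount (2 ^ rk c n * 3 ^ rk c n) ptr + 1) := by
  have hB1 : 1 ≤ B := by have := hP.pos; omega
  refine Tri.cond (T := 2 + 2 ^ rk c n * (9 + n * 15) + (3 + 2 ^ rk c n * (14 + 2 ^ rk c n * 12)))
    (T' := 1) (by decide) (fun he => ?_) (fun he => Tri.skip (Or.inl ?_))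
  · have hv := h13.1 he
    refine Tri.seq (Tri.framed (cutVecs_spec hn hc h3 hN rfl rfl hlab hr1 hr2 hB1) ?_)
    rintro υ hF' ⟨hw1, hw2⟩
    refine Tri.framed (reduce_spec (U' := spanOf n c W (O ++ [i]))
      ((hF'.1 3 (by decide)).trans h3) ((hF'.1 4 (by decide)).trans h4)
      ((hF'.1 14 (by decide)).trans h14) ((hF'.1 18 (by decide)).trans h18)
      ((hF'.1 19 (by decide)).trans h19) rfl ((hF'.2 12 (by decide)).trans hp)
      ((hF'.2 13 (by decide)).trans hr) hP
      (spanOf_mono (List.subset_append_left _ _)) (degKey_lt hv) hw1 ?_ hB ?_) ?_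
    · rw [hw2]
      exact Submodule.subset_span ⟨i, by simp, rfl, rfl⟩
    · have := degKey_lt hv; omega
    · rintro ω - (⟨l1, l2, l3, l4, l5⟩ | ⟨l1, l2, l3, l4⟩)
      · exact Or.inl ⟨l1, l2, l3, l4, fun _ => hw2 ▸ l5⟩
      · exact Or.inr ⟨l1, l2, hv, l3, l4⟩
  · exact ⟨h19, h18, hp, hr, fun hv => absurd he (h13.2 hv)⟩

/-- Outputs, stored rows and pivots grow in step, one of each per kept set. A valid set that is not
kept already has its cut vector in the span. -/
theorem step_spec {B n m i : ℕ} {a c W : ℕ → ℕ} {σ : State} (hn : σ.var 0 = n)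
    (h3 : σ.var 3 = 2 ^ rk c n) (h4 : σ.var 4 = 3 ^ rk c n) (ha : σ.arr 1 = a) (hc : σ.arr 2 = c)
    (hW : σ.arr 3 = W) (hN : ∀ r < 2 ^ rk c n, σ.arr 5 r = r / 2 ∧ σ.arr 6 r = r % 2)
    (him : i < m) (hB1 : 1 + m * 2 ^ rk c n ≤ B) (hB2 : m * (n * n) ≤ B) (hB3 : n * 3 ^ rk c n ≤ B)
    (hB4 : 3 ^ rk c n + 2 ^ rk c n * 3 ^ rk c n ≤ B) (hI : MainInv n a c W i σ) :
    Tri B step σ (stepTime n (2 ^ rk c n)) fun τ => MainInv n a c W (i + 1) τ := by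
  obtain ⟨O, hO, hout, h20, h5, h18, hcnt, hP⟩ := hI
  have hlen : O.length ≤ i := by simpa using hO.sublist.length_le
  have hmB : m ≤ B := le_trans (Nat.le_mul_of_pos_right m (by positivity))
    (by omega : m * 2 ^ rk c n ≤ B)
  have hbB : i * (n * n) + n * n ≤ B := by
    rw [← Nat.succ_mul]; exact (Nat.mul_le_mul_right _ him).trans hB2
  have hoB : O.length * (n * n) + n * n ≤ B := by
    rw [← Nat.succ_mul]; exact (Nat.mul_le_mul_right _ (by omega)).trans hB2
  have htB : 1 + O.length * 2 ^ rk c n + 2 ^ rk c n ≤ B := by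
    rw [add_assoc, ← Nat.succ_mul]
    exact (Nat.add_le_add_left (Nat.mul_le_mul_right _ (by omega)) _).trans hB1
  refine Tri.seq (Tri.framed (analyse_spec hn h5 ha hc hW hbB hB3 (by omega)) ?_)
  rintro τ hF ⟨k6, k14, k13, klab, krep, krep'⟩
  have kn : τ.var 0 = n := (hF.1 0 (by decide)).trans hn
  have k3 : τ.var 3 = 2 ^ rk c n := (hF.1 3 (by decide)).trans h3
  have k4 : τ.var 4 = 3 ^ rk c n := (hF.1 4 (by decide)).trans h4
  have k5 : τ.var 5 = i * (n * n) := (hF.1 5 (by decide)).trans h5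
  have k2 : τ.var 2 = O.length := (hF.1 2 (by decide)).trans hout.1
  have k18 : τ.var 18 = 1 + O.length * 2 ^ rk c n := (hF.1 18 (by decide)).trans h18
  have k20 : τ.var 20 = O.length * (n * n) := (hF.1 20 (by decide)).trans h20
  have kc : τ.arr 2 = c := (hF.2 2 (by decide)).trans hc
  have kW : τ.arr 3 = W := (hF.2 3 (by decide)).trans hW
  have k12 : τ.arr 12 = σ.arr 12 := hF.2 12 (by decide)
  have k13' : τ.arr 13 = σ.arr 13 := hF.2 13 (by decide)
  have kout : τ.arr 4 = σ.arr 4 := hF.2 4 (by decide)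
  rw [h18] at hP
  refine Tri.seq (Tri.assign (by decide) (by simp [Expr.eval]) ?_)
  refine Tri.seq (Tri.framed (eliminate_spec (a := a) (W := W) (i := i) (by simpa using kn)
    (by simpa using k3) (by simpa using k4) (by simpa using kc)
    (by simpa [hF.2 5 (by decide), hF.2 6 (by decide)] using hN) (by simpa using k18)
    (by simp [Expr.eval]) k12 k13' (by simpa using k14) (by simpa using k13) klab krep krep' hP
    htB hB4) ?_)
  intro υ hF' hυ
  have kv : ∀ x, x ∉ 19 :: eliminate.wv → υ.var x = τ.var x := fun x hx => by
    simp only [List.mem_cons, not_or] at hx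
    rw [hF'.1 x hx.2]
    simp [hx.1]
  have ka : ∀ x, x ∉ eliminate.wa → υ.arr x = τ.arr x := fun x hx => hF'.2 x hx
  refine Tri.framed (emit_spec ((kv 0 (by decide)).trans kn) ((kv 5 (by decide)).trans k5)
    ((kv 6 (by decide)).trans k6) ((kv 20 (by decide)).trans k20) ((kv 2 (by decide)).trans k2)
    ((ka 3 (by decide)).trans kW) ((ka 4 (by decide)).trans kout) hbB hoB (by omega)) ?_
  rintro ω hF'' ⟨l5, l0, l1⟩
  have l12 : ω.arr 12 = υ.arr 12 := hF''.2 12 (by decide)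
  have l13 : ω.arr 13 = υ.arr 13 := hF''.2 13 (by decide)
  have l18 : ω.var 18 = υ.var 18 := hF''.1 18 (by decide)
  have e5 : i * (n * n) + n * n = (i + 1) * (n * n) := by ring
  rcases hυ with ⟨u19, u18, u12, u13, umem⟩ | ⟨u19, u18, uv, uP, ucnt⟩
  · obtain ⟨l2, l20, l4⟩ := l0 u19
    refine ⟨O, ⟨hO.sublist.trans (by simp [List.range_succ]), hO.valid, fun k hk hv => ?_⟩,
      ⟨l2, by rw [l4]; exact hout.2⟩, l20, l5.trans e5, by rw [l18, u18],
      by rw [l12, u12, hcnt], by rw [l12, u12, l13, u13, l18, u18]; exact hP⟩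
    rcases Nat.lt_succ_iff_lt_or_eq.1 hk with h | rfl
    exacts [hO.mem k h hv, umem hv]
  · obtain ⟨l2, l20, l4, l4'⟩ := l1 (by omega)
    refine ⟨O ++ [i], ⟨?_, ?_, fun k hk hv => ?_⟩, ⟨by simp [l2], ?_⟩, ?_, l5.trans e5, ?_, ?_, ?_⟩
    · rw [List.range_succ]
      exact hO.sublist.append (List.Sublist.refl _)
    · intro k hk
      rcases List.mem_append.1 hk with h | h
      · exact hO.valid k h
      · rw [List.mem_singleton.1 h]; exact uv
    · rcases Nat.lt_succ_iff_lt_or_eq.1 hk with h | rfl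
      · exact spanOf_mono (List.subset_append_left _ _) _ (hO.mem k h hv)
      · exact Submodule.subset_span ⟨k, by simp, rfl, rfl⟩
    · intro t ht j hj
      by_cases h : t < O.length
      · have hle := Nat.mul_le_mul_right (n * n) h
        rw [Nat.succ_mul] at hle
        rw [l4 _ (by omega), hout.2 t h j hj, List.getElem_append_left h]
      · have : t = O.length := by simp at ht; omega
        subst this
        rw [l4' j hj]
        simp
    · rw [l20]; simp; ring
    · rw [l18, u18]; simp; ring
    · rw [l12, ucnt, hcnt]; simp
    · rw [l12, l13, l18, u18]; exact uP

/-- The whole program. -/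
def program : Prog :=
  .seq powers (.seq halves (.seq (.assign 18 (.const 1)) (.forN 7 1 step)))

/-- The number of operations of the program on `n` vertices and `m` edge sets with vectors of
length `N`. -/
def totalTime (n m N : ℕ) : ℕ :=
  (4 + n * 7) + ((2 + N * 7) + (1 + (2 + m * (stepTime n N + 3))))

theorem program_spec {B n m : ℕ} {a c W : ℕ → ℕ} {σ : State} (hn : σ.var 0 = n) (hm : σ.var 1 = m)
    (hz : ∀ x, 1 < x → σ.var x = 0) (ha : σ.arr 1 = a) (hc : σ.arr 2 = c) (hW : σ.arr 3 = W)
    (h12 : ∀ q, σ.arr 12 q = 0) (hB1 : 1 + m * 2 ^ rk c n ≤ B) (hB2 : m * (n * n) ≤ B)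
    (hB3 : n * 3 ^ rk c n ≤ B) (hB4 : 3 ^ rk c n + 2 ^ rk c n * 3 ^ rk c n ≤ B) :
    Tri B program σ (totalTime n m (2 ^ rk c n)) fun τ => ∃ O, Represents n a c W m O ∧
      Holds n W O τ ∧ O.length ≤ 6 ^ rk c n := by
  refine Tri.seq (Tri.framed (powers_spec hn hc (by omega)) ?_)
  rintro τ hF ⟨h3, h4⟩
  refine Tri.seq (Tri.framed (halves_spec h3 (by omega)) ?_)
  rintro υ hF' hhalf
  have hvar : ∀ x, x ∉ [8, 3, 4, 15] → υ.var x = σ.var x := fun x hx => by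
    rw [hF'.1 x (by simp [halves, Prog.forN, Prog.wv] at hx ⊢; omega),
      hF.1 x (by simp [powers, Prog.forN, Prog.wv] at hx ⊢; omega)]
  have harr : ∀ x, x ∉ [5, 6] → υ.arr x = σ.arr x := fun x hx => by
    rw [hF'.2 x (by simp [halves, Prog.forN, Prog.wa] at hx ⊢; omega),
      hF.2 x (by simp [powers, Prog.forN, Prog.wa])]
  have h3' : υ.var 3 = 2 ^ rk c n := by rw [hF'.1 3 (by decide), h3]
  have h4' : υ.var 4 = 3 ^ rk c n := by rw [hF'.1 4 (by decide), h4]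
  have hpt : ∀ q, υ.arr 12 q = 0 := fun q => by rw [harr 12 (by decide)]; exact h12 q
  refine Tri.seq (Tri.assign (by decide) (by simp [Expr.eval]; omega) (Tri.forN m
    (MainInv n a c W) (by decide) (by decide) (by simpa [hvar 1 (by decide)] using hm) ?_ ?_ ?_))
  · refine ⟨[], ⟨by simp, by simp, by simp⟩, ⟨?_, by simp⟩, ?_, ?_, ?_, ?_, ?_⟩
    · simp [hvar 2 (by decide), hz 2]
    · simp [hvar 20 (by decide), hz 20]
    · simp [hvar 5 (by decide), hz 5]
    · simp [Expr.eval]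
    · simp [pivotCount, hpt]
    · constructor <;> simp [hpt, Expr.eval]
  · rintro i hi ω hω h7 hI
    have kv : ∀ x, x ∉ 18 :: 7 :: step.wv → ω.var x = υ.var x := fun x hx => by
      rw [hω.1 x (fun h => hx (List.mem_cons_of_mem _ h))]
      simp only [List.mem_cons, not_or] at hx
      simp [hx.1]
    have ka : ∀ x, x ∉ step.wa → ω.arr x = υ.arr x := fun x hx => by
      rw [hω.2 x hx]; simp
    refine Tri.framed (step_spec (m := m) (i := i) (a := a) (c := c) (W := W)
      ((kv 0 (by decide)).trans ((hvar 0 (by decide)).trans hn))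
      ((kv 3 (by decide)).trans h3') ((kv 4 (by decide)).trans h4')
      ((ka 1 (by decide)).trans ((harr 1 (by decide)).trans ha))
      ((ka 2 (by decide)).trans ((harr 2 (by decide)).trans hc))
      ((ka 3 (by decide)).trans ((harr 3 (by decide)).trans hW))
      (by rw [ka 5 (by decide), ka 6 (by decide)]; exact hhalf)
      hi hB1 hB2 hB3 hB4 hI) fun χ _ h => ?_
    simpa [MainInv, Holds] using h
  · rintro ω - - ⟨O, hO, hH, -, -, -, hcnt, -⟩
    refine ⟨O, hO, hH, ?_⟩
    -- There are as many kept sets as occupied cells among the 2^r · 3^r pivot cells; linear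
    -- independence is not needed for the count.
    rw [← hcnt, show (6 : ℕ) = 2 * 3 by norm_num, mul_pow]
    exact pivotCount_le _ _

end Reduction

/-! ### Hamiltonian cycles and colourings -/

namespace Reduction

variable {V : Type*}

/-- The colouring `f` is constant along the edges in `X`. -/
def Mono (X : Finset (Sym2 V)) (f : V → ZMod 2) : Prop := ∀ u v, s(u, v) ∈ X → f u = f v

theorem Mono.eq_of_mem_support {G : SimpleGraph V} {F : Finset (Sym2 V)} {f : V → ZMod 2}
    (hf : Mono F f) {a b : V} (p : G.Walk a b) (hp : ∀ e ∈ p.edges, e ∈ F) :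
    ∀ w ∈ p.support, f w = f a := by
  induction p with
  | nil => simp
  | cons h p ih =>
    intro w hw
    rw [SimpleGraph.Walk.edges_cons] at hp
    rw [SimpleGraph.Walk.support_cons, List.mem_cons] at hw
    rcases hw with rfl | hw
    · rfl
    · rw [ih (fun e he => hp e (List.mem_cons_of_mem _ he)) w hw]
      exact (hf _ _ (hp _ List.mem_cons_self)).symm

theorem Mono.add {X : Finset (Sym2 V)} {f g : V → ZMod 2} (hf : Mono X f) (hg : Mono X g) :
    Mono X (f + g) := fun u v h => by simp [hf u v h, hg u v h]

variable [DecidableEq V]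

/-! ### Hamiltonicity through degrees and colourings -/

/-- The degree of `v` in the edge set `X`. -/
def degree [Fintype V] (X : Finset (Sym2 V)) (v : V) : ℕ :=
  (Finset.univ.filter fun u => s(v, u) ∈ X).card

theorem degree_union [Fintype V] {X Y : Finset (Sym2 V)} (h : Disjoint X Y) (v : V) :
    degree (X ∪ Y) v = degree X v + degree Y v := by
  unfold degree
  rw [← Finset.card_union_of_disjoint]
  · congr 1
    ext u
    simp
  · rw [Finset.disjoint_filter]
    exact fun u _ h1 h2 => Finset.disjoint_left.1 h h1 h2

theorem mono_union {X Y : Finset (Sym2 V)} {f : V → ZMod 2} :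
    Mono (X ∪ Y) f ↔ Mono X f ∧ Mono Y f :=
  ⟨fun h => ⟨fun u v he => h u v (Finset.mem_union_left _ he),
    fun u v he => h u v (Finset.mem_union_right _ he)⟩,
    fun h u v he => (Finset.mem_union.1 he).elim (h.1 u v) (h.2 u v)⟩

theorem degree_eq_two_of_isHamiltonian [Fintype V] {G : SimpleGraph V} {F : Finset (Sym2 V)}
    (h : IsHamiltonianEdgeSet G F) (v : V) : degree F v = 2 := by
  obtain ⟨w, p, hp, rfl⟩ := h
  rw [← hp.isCycle.ncard_neighborSet_toSubgraph_eq_two (hp.mem_support v), degree,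
    ← Set.ncard_coe_finset]
  congr 1
  ext u
  simp [SimpleGraph.Walk.adj_toSubgraph_iff_mem_edges]

theorem eq_of_isHamiltonian {G : SimpleGraph V} {F : Finset (Sym2 V)}
    (h : IsHamiltonianEdgeSet G F) {f : V → ZMod 2} (hf : Mono F f) (u v : V) : f u = f v := by
  obtain ⟨w, p, hp, rfl⟩ := h
  rw [hf.eq_of_mem_support p (by simp) u (hp.mem_support u),
    hf.eq_of_mem_support p (by simp) v (hp.mem_support v)]

/-- A connected 2-regular graph is a single cycle: some cycle spans the component of a vertex, which
is everything, and 2-regularity leaves no edge outside it. -/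
theorem isHamiltonianEdgeSet_of_degree [Fintype V] [Nonempty V] {G : SimpleGraph V}
    {F : Finset (Sym2 V)} (hF : (F : Set (Sym2 V)) ⊆ G.edgeSet) (hd : ∀ v, degree F v = 2)
    (hc : ∀ f, Mono F f → ∀ u v, f u = f v) : IsHamiltonianEdgeSet G F := by
  classical
  set H := SimpleGraph.fromEdgeSet (F : Set (Sym2 V)) with hH
  have hadj : ∀ u v, H.Adj u v ↔ s(u, v) ∈ F := fun u v => by
    rw [hH, SimpleGraph.fromEdgeSet_adj]
    exact ⟨fun h => h.1, fun h => ⟨h, (G.mem_edgeSet.1 (hF h)).ne⟩⟩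
  have hle : H ≤ G := fun u v h => G.mem_edgeSet.1 (hF ((hadj u v).1 h))
  have hn : ∀ v, (H.neighborSet v).ncard = 2 := fun v => by
    rw [← hd v, degree, ← Set.ncard_coe_finset]
    congr 1
    ext u
    simp [hadj]
  have hpre : ∀ u v, H.Reachable u v := fun u v => by
    -- The indicator of the component of `u` is constant along edges, hence constant.
    have := hc (fun w => if H.Reachable u w then 1 else 0) (fun a b hab => by
      have hab' : H.Adj a b := (hadj a b).2 hab
      exact if_congr ⟨fun h => h.trans hab'.reachable, fun h => h.trans hab'.symm.reachable⟩
        rfl rfl) u v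
    by_contra hne
    simp [hne] at this
  obtain ⟨v⟩ := ‹Nonempty V›
  have hcyc : H.IsCycles := fun v _ => hn v
  obtain ⟨p, hp, hpv⟩ := hcyc.exists_cycle_toSubgraph_verts_eq_connectedComponentSupp
    (c := H.connectedComponentMk v) (v := v) rfl
    (Set.nonempty_of_ncard_ne_zero (by rw [hn]; norm_num))
  have hsupp : ∀ w, w ∈ p.support := fun w => by
    rw [← SimpleGraph.Walk.mem_verts_toSubgraph, hpv]
    exact SimpleGraph.ConnectedComponent.sound (hpre w v)
  refine ⟨v, p.mapLe hle, ?_, ?_⟩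
  · rw [SimpleGraph.Walk.isHamiltonianCycle_iff_isCycle_and_support_count_tail_eq_one]
    refine ⟨hp.mapLe hle, fun a => ?_⟩
    rw [SimpleGraph.Walk.support_mapLe_eq_support]
    refine List.count_eq_one_of_mem hp.support_nodup ?_
    have := hsupp a
    rw [SimpleGraph.Walk.mem_support_iff] at this
    rcases this with rfl | h
    · exact SimpleGraph.Walk.end_mem_tail_support hp.not_nil
    · exact h
  · rw [SimpleGraph.Walk.edges_mapLe_eq_edges]
    ext e
    induction e with | _ a b
    rw [List.mem_toFinset]
    refine ⟨fun h => (hadj a b).1 (SimpleGraph.Walk.adj_of_mem_edges p h), fun h => ?_⟩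
    -- One set of neighbours contains the other and both have two elements.
    have heq : p.toSubgraph.neighborSet a = H.neighborSet a :=
      Set.eq_of_subset_of_ncard_le (p.toSubgraph.neighborSet_subset a)
        (by rw [hn, hp.ncard_neighborSet_toSubgraph_eq_two (hsupp a)]) (Set.toFinite _)
    have : b ∈ p.toSubgraph.neighborSet a := by rw [heq]; exact (hadj a b).2 h
    exact SimpleGraph.Walk.adj_toSubgraph_iff_mem_edges.1 this

theorem eq_of_degree_eq_one [Fintype V] {X : Finset (Sym2 V)} {u v w : V} (h : degree X u = 1)
    (hv : s(u, v) ∈ X) (hw : s(u, w) ∈ X) : v = w := by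
  obtain ⟨x, hx⟩ := Finset.card_eq_one.1 h
  have h1 : v ∈ ({x} : Finset V) := hx ▸ by simpa
  have h2 : w ∈ ({x} : Finset V) := hx ▸ by simpa
  rw [Finset.mem_singleton.1 h1, Finset.mem_singleton.1 h2]

/-- At both ends of a shared edge `X` and `Y` have degree 1, so neither has a further edge there.
The indicator of the two ends is then compatible with both sets, and a third vertex makes it
nonconstant. -/
theorem disjoint_of_degree [Fintype V] {X Y : Finset (Sym2 V)} (hV : 3 ≤ Fintype.card V)
    (hd : ∀ v, degree X v + degree Y v = 2)
    (hc : ∀ f, Mono X f → Mono Y f → ∀ u v, f u = f v) : Disjoint X Y := by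
  rw [Finset.disjoint_left]
  intro e hX hY
  induction e with | _ u v
  have hpos : ∀ (Z : Finset (Sym2 V)) (a b : V), s(a, b) ∈ Z → 0 < degree Z a := fun Z a b h =>
    Finset.card_pos.2 ⟨b, by simpa⟩
  have hX' : s(v, u) ∈ X := Sym2.eq_swap ▸ hX
  have hY' : s(v, u) ∈ Y := Sym2.eq_swap ▸ hY
  have key : ∀ Z : Finset (Sym2 V), s(u, v) ∈ Z → degree Z u = 1 → degree Z v = 1 →
      Mono Z fun w => if w = u ∨ w = v then 1 else 0 := by
    intro Z hZ hu hv a b hab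
    have hZ' : s(v, u) ∈ Z := Sym2.eq_swap ▸ hZ
    have hba : s(b, a) ∈ Z := Sym2.eq_swap ▸ hab
    refine if_congr ⟨?_, ?_⟩ rfl rfl
    · rintro (rfl | rfl)
      · exact Or.inr (eq_of_degree_eq_one hu hab hZ)
      · exact Or.inl (eq_of_degree_eq_one hv hab hZ')
    · rintro (rfl | rfl)
      · exact Or.inr (eq_of_degree_eq_one hu hba hZ)
      · exact Or.inl (eq_of_degree_eq_one hv hba hZ')
  have h1 := hpos X u v hX
  have h2 := hpos Y u v hY
  have h3 := hpos X v u hX'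
  have h4 := hpos Y v u hY'
  have h5 := hd u
  have h6 := hd v
  have hconst := hc _ (key X hX (by omega) (by omega)) (key Y hY (by omega) (by omega)) u
  have hsub : (Finset.univ : Finset V) ⊆ {u, v} := fun w _ => by
    have := hconst w
    simp only [true_or, if_true] at this
    by_contra hw
    simp only [Finset.mem_insert, Finset.mem_singleton] at hw
    simp [hw] at this
  have := (Finset.card_le_card hsub).trans Finset.card_le_two
  rw [Finset.card_univ] at this
  omega

theorem hamiltonian_iff [Fintype V] {G : SimpleGraph V} {X Y : Finset (Sym2 V)}
    (hV : 3 ≤ Fintype.card V) (hX : (X : Set (Sym2 V)) ⊆ G.edgeSet)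
    (hY : (Y : Set (Sym2 V)) ⊆ G.edgeSet) :
    (Disjoint X Y ∧ IsHamiltonianEdgeSet G (X ∪ Y)) ↔
      (∀ v, degree X v + degree Y v = 2) ∧
        ∀ f, Mono X f → Mono Y f → ∀ u v, f u = f v := by
  constructor
  · rintro ⟨hd, h⟩
    exact ⟨fun v => by rw [← degree_union hd, degree_eq_two_of_isHamiltonian h],
      fun f h1 h2 => eq_of_isHamiltonian h (mono_union.2 ⟨h1, h2⟩)⟩
  · rintro ⟨hd, h⟩
    have hdis := disjoint_of_degree hV hd h
    have : Nonempty V := Fintype.card_pos_iff.1 (by omega)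
    refine ⟨hdis, isHamiltonianEdgeSet_of_degree ?_ (fun v => by rw [degree_union hdis, hd])
      fun f hf => h f (mono_union.1 hf).1 (mono_union.1 hf).2⟩
    rw [Finset.coe_union]
    exact Set.union_subset hX hY

/-- In a Hamiltonian cycle, every vertex in `A \ C` is tied to `C`. -/
theorem exists_mem_separator {A C : Finset V} {v₀ : V} (hv₀ : v₀ ∈ C) {X Y : Finset (Sym2 V)}
    (hX : ∀ u v, s(u, v) ∈ X → u ∈ A ∪ C) (hY : ∀ u v, s(u, v) ∈ Y → u ∈ A → u ∈ C)
    (hc : ∀ f, Mono X f → Mono Y f → ∀ u v, f u = f v) {v : V} (hv : v ∈ A) :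
    ∃ u ∈ C, ∀ f, Mono X f → f u = f v := by
  by_contra! hcon
  choose! f hf hfv using hcon
  -- If no vertex of `C` is tied to `v`, each `u` in `C` has a colouring `f u` separating it from
  -- `v`. The product is the indicator of agreeing with `v` in all of them: it is 1 at `v` and 0 on
  -- `C`.
  set h : V → ZMod 2 := fun w => ∏ u ∈ C, (f u w + f u v + 1) with hh
  have hX' : Mono X h := fun a b hab => Finset.prod_congr rfl fun u hu => by
    rw [hf u hu a b hab]
  have h1 : h v = 1 := Finset.prod_eq_one fun u _ => by rw [CharTwo.add_self_eq_zero, zero_add]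
  have h0 : ∀ w ∈ C, h w = 0 := fun w hw => Finset.prod_eq_zero hw <| by
    have := hfv w hw
    generalize f w w = x at *
    generalize f w v = y at *
    revert x y
    decide
  -- As `h` vanishes on `C`, cutting it off outside `A` changes nothing along `X`, and gives zero at
  -- all ends of edges in `Y`. The result is compatible with both but differs at `v` and `v₀`.
  have := hc (fun w => if w ∈ A then h w else 0) (fun a b hab => ?_) (fun a b hab => ?_) v v₀
  · simp only [hv, if_true, h1, h0 v₀ hv₀] at this
    split_ifs at this <;> simp at this
  · have key : ∀ w ∈ A ∪ C, (if w ∈ A then h w else 0) = h w := fun w hw => by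
      split_ifs with hwA
      · rfl
      · exact (h0 w ((Finset.mem_union.1 hw).resolve_left hwA)).symm
    beta_reduce
    rw [key a (hX a b hab), key b (hX b a (Sym2.eq_swap ▸ hab)), hX' a b hab]
  · have key : ∀ w, (w ∈ A → w ∈ C) → (if w ∈ A then h w else 0) = 0 := fun w hw => by
      split_ifs with hwA
      · exact h0 w (hw hwA)
      · rfl
    beta_reduce
    rw [key a (hY a b hab), key b (hY b a (Sym2.eq_swap ▸ hab))]

/-! ### Counting colourings modulo 2 -/

section Count

variable [Fintype V]

open Classical in
/-- The colourings that vanish at `v₀` and are constant along the edges in `X` and `Y`. -/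
noncomputable def colourings (v₀ : V) (X Y : Finset (Sym2 V)) : Finset (V → ZMod 2) :=
  Finset.univ.filter fun f => f v₀ = 0 ∧ Mono X f ∧ Mono Y f

/-- A nonconstant compatible colouring, shifted to vanish at `v₀`, gives some `g ≠ 0`; adding `g` is
an involution without fixed points, so the number is even. Otherwise only the zero colouring is
counted. -/
theorem card_colourings_ne_zero_iff (v₀ : V) (X Y : Finset (Sym2 V)) :
    ((colourings v₀ X Y).card : ZMod 2) ≠ 0 ↔ ∀ f, Mono X f → Mono Y f → ∀ u v, f u = f v := by
  constructor
  · intro hne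
    by_contra! hcon
    obtain ⟨f, hX, hY, u, v, huv⟩ := hcon
    set g : V → ZMod 2 := f + fun _ => f v₀ with hg
    have hconst : ∀ Z : Finset (Sym2 V), Mono Z fun _ => f v₀ := fun Z _ _ _ => rfl
    have hgX : Mono X g := hX.add (hconst X)
    have hgY : Mono Y g := hY.add (hconst Y)
    have hgv : g v₀ = 0 := CharTwo.add_self_eq_zero _
    have hg0 : g ≠ 0 := fun h0 => huv <| by
      have h1 := congrFun h0 u
      have h2 := congrFun h0 v
      simp only [hg, Pi.add_apply, Pi.zero_apply] at h1 h2
      exact add_right_cancel (h1.trans h2.symm)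
    apply hne
    rw [Finset.card_eq_sum_ones, Nat.cast_sum]
    refine Finset.sum_involution (fun f _ => f + g) (fun _ _ => by decide) (fun f _ _ h => ?_)
      (fun f hf => ?_) fun f _ => ?_
    · exact hg0 (by simpa using h)
    · simp only [colourings, Finset.mem_filter, Finset.mem_univ, true_and] at hf ⊢
      exact ⟨by simp [hf.1, hgv], hf.2.1.add hgX, hf.2.2.add hgY⟩
    · funext w
      simp only [Pi.add_apply, add_assoc, CharTwo.add_self_eq_zero, add_zero]
  · intro h
    have : colourings v₀ X Y = {0} := by
      ext f
      simp only [colourings, Finset.mem_filter, Finset.mem_univ, true_and, Finset.mem_singleton]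
      constructor
      · rintro ⟨h0, h1, h2⟩
        funext v
        rw [h f h1 h2 v v₀, h0, Pi.zero_apply]
      · rintro rfl
        exact ⟨rfl, fun _ _ _ => rfl, fun _ _ _ => rfl⟩
    simp [this]

variable {ι : Type*} [Fintype ι] (A C : Finset V) (col : ι → V → ZMod 2)

open Classical in
/-- The indicator of the colourings of `C` that extend to colourings constant along `X`. -/
noncomputable def extension (X : Finset (Sym2 V)) (j : ι) : ZMod 2 :=
  if ∃ f, Mono X f ∧ ∀ v ∈ C, f v = col j v then 1 else 0

open Classical in
/-- The colourings extending a colouring of `C` that vanish at `v₀` and on `A \ C` and are constant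
along `Y`. -/
noncomputable def outer (v₀ : V) (Y : Finset (Sym2 V)) (j : ι) : Finset (V → ZMod 2) :=
  Finset.univ.filter fun f => f v₀ = 0 ∧ Mono Y f ∧ (∀ v ∈ C, f v = col j v) ∧
    ∀ v ∈ A, v ∉ C → f v = 0

variable {A C col}

/-- The colourings are grouped by their restriction to `C`. Inside a group the values on `A \ C` are
forced, since these vertices are tied to `C`; overwriting them by 0 is thus injective and removes
all reference to `X`. -/
theorem card_colourings_eq_sum {v₀ : V} (hv₀ : v₀ ∈ C) {X Y : Finset (Sym2 V)}
    (hcol : ∀ f : V → ZMod 2, ∃! j, ∀ v ∈ C, f v = col j v)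
    (hX : ∀ u v, s(u, v) ∈ X → u ∈ A ∪ C) (hY : ∀ u v, s(u, v) ∈ Y → u ∈ A → u ∈ C)
    (hA : ∀ v ∈ A, v ∉ C → ∃ u ∈ C, ∀ f, Mono X f → f u = f v) :
    ((colourings v₀ X Y).card : ZMod 2) =
      ∑ j, extension C col X j * ((outer A C col v₀ Y j).card : ZMod 2) := by
  classical
  choose idx hidx hidx' using hcol
  rw [Finset.card_eq_sum_card_fiberwise (f := idx) (t := Finset.univ) (by simp), Nat.cast_sum]
  refine Finset.sum_congr rfl fun j _ => ?_
  have hmem : ∀ f, f ∈ (colourings v₀ X Y).filter (fun f => idx f = j) ↔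
      (f v₀ = 0 ∧ Mono X f ∧ Mono Y f) ∧ ∀ v ∈ C, f v = col j v := fun f => by
    simp only [colourings, Finset.mem_filter, Finset.mem_univ, true_and]
    refine and_congr_right fun _ => ⟨fun h => h ▸ hidx f, fun h => (hidx' f j h).symm⟩
  unfold extension
  split_ifs with hex
  · obtain ⟨h, hhX, hhC⟩ := hex
    rw [one_mul]
    congr 1
    refine Finset.card_bij (fun f _ v => if v ∈ A ∧ v ∉ C then 0 else f v) ?_ ?_ ?_
    · intro f hf
      obtain ⟨⟨h0, h1, h2⟩, h3⟩ := (hmem f).1 hf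
      simp only [outer, Finset.mem_filter, Finset.mem_univ, true_and]
      refine ⟨by simp [hv₀, h0], fun u v huv => ?_, fun v hv => by simp [hv, h3 v hv],
        fun v hv hv' => by simp [hv, hv']⟩
      have hu := hY u v huv
      have hv := hY v u (Sym2.eq_swap ▸ huv)
      beta_reduce
      rw [if_neg (by tauto), if_neg (by tauto)]
      exact h2 u v huv
    · intro f hf f' hf' heq
      obtain ⟨⟨-, h1, -⟩, h3⟩ := (hmem f).1 hf
      obtain ⟨⟨-, h1', -⟩, h3'⟩ := (hmem f').1 hf'
      funext v
      by_cases hv : v ∈ A ∧ v ∉ C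
      · obtain ⟨u, hu, huv⟩ := hA v hv.1 hv.2
        rw [← huv f h1, ← huv f' h1', h3 u hu, h3' u hu]
      · simpa [hv] using congrFun heq v
    · intro g hg
      simp only [outer, Finset.mem_filter, Finset.mem_univ, true_and] at hg
      obtain ⟨g0, gY, gC, gA⟩ := hg
      -- For the inverse, an extension `h` along `X` is glued in on `A \ C`; it agrees with `g` on
      -- `C`, so the result equals `h` wherever `X` has edges.
      have hfh : ∀ v ∈ A ∪ C, (if v ∈ A ∧ v ∉ C then h v else g v) = h v := fun v hv => by
        split_ifs with hv'
        · rfl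
        · have : v ∈ C := by
            rcases Finset.mem_union.1 hv with h | h
            · by_contra hvC; exact hv' ⟨h, hvC⟩
            · exact h
          rw [gC v this, hhC v this]
      refine ⟨fun v => if v ∈ A ∧ v ∉ C then h v else g v, (hmem _).2 ⟨⟨?_, ?_, ?_⟩, ?_⟩, ?_⟩
      · simp [hv₀, g0]
      · intro u v huv
        beta_reduce
        rw [hfh u (hX u v huv), hfh v (hX v u (Sym2.eq_swap ▸ huv))]
        exact hhX u v huv
      · intro u v huv
        have hu := hY u v huv
        have hv := hY v u (Sym2.eq_swap ▸ huv)
        beta_reduce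
        rw [if_neg (by tauto), if_neg (by tauto)]
        exact gY u v huv
      · intro v hv
        simp [hv, gC v hv]
      · funext v
        by_cases hv : v ∈ A ∧ v ∉ C
        · simp [hv, gA v hv.1 hv.2]
        · simp [hv]
  · rw [zero_mul, Finset.card_eq_zero.2, Nat.cast_zero]
    refine Finset.eq_empty_of_forall_notMem fun f hf => hex ?_
    obtain ⟨⟨-, h1, -⟩, h3⟩ := (hmem f).1 hf
    exact ⟨f, h1, h3⟩

end Count

end Reduction

/-! ### Correctness of the reduction -/

namespace Reduction

/-! ### Colourings as binary numbers -/

theorem colour_mod (c : ℕ → ℕ) (j v : ℕ) {K : ℕ} (h : rk c v < K) :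
    colour c (j % 2 ^ K) v = colour c j v := by
  obtain ⟨d, rfl⟩ := Nat.exists_eq_add_of_lt h
  unfold colour
  rw [add_assoc, pow_add, Nat.mod_mul_right_div_self,
    Nat.mod_mod_of_dvd _ (dvd_pow_self 2 (by omega))]

theorem rk_lt {c : ℕ → ℕ} {v k : ℕ} (hv : v < k) (hc : c v ≠ 0) : rk c v < rk c k := by
  have := rk_mono c (show v + 1 ≤ k from hv)
  rw [rk_succ, if_neg hc] at this
  exact this

theorem mod_eq_of_colour_eq {c : ℕ → ℕ} {j j' : ℕ} (k : ℕ)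
    (h : ∀ v < k, c v ≠ 0 → colour c j v = colour c j' v) :
    j % 2 ^ rk c k = j' % 2 ^ rk c k := by
  induction k with
  | zero => simp [Nat.mod_one]
  | succ k ih =>
    have ih := ih fun v hv => h v (by omega)
    rw [rk_succ]
    split_ifs with hc
    · exact ih
    · have := h k (by omega) hc
      unfold colour at this
      rw [Nat.mod_pow_succ, Nat.mod_pow_succ, ih, this]

theorem exists_colour_eq (c : ℕ → ℕ) (f : ℕ → ZMod 2) (k : ℕ) :
    ∃ j < 2 ^ rk c k, ∀ v < k, c v ≠ 0 → f v = (colour c j v : ℕ) := by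
  induction k with
  | zero => exact ⟨0, by simp, by simp⟩
  | succ k ih =>
    obtain ⟨j, hj, hjf⟩ := ih
    rw [rk_succ]
    split_ifs with hc
    · refine ⟨j, hj, fun v hv hcv => ?_⟩
      rcases Nat.lt_succ_iff_lt_or_eq.1 hv with h | rfl
      exacts [hjf v h hcv, absurd hc hcv]
    · have hval : (f k).val < 2 := ZMod.val_lt _
      have hmod : (j + 2 ^ rk c k * (f k).val) % 2 ^ rk c k = j := by
        rw [Nat.add_mul_mod_self_left, Nat.mod_eq_of_lt hj]
      -- The new vertex supplies the leading binary digit and leaves the lower ones alone.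
      refine ⟨j + 2 ^ rk c k * (f k).val, ?_, fun v hv hcv => ?_⟩
      · rw [pow_succ]
        have : 2 ^ rk c k * (f k).val ≤ 2 ^ rk c k * 1 := Nat.mul_le_mul_left _ (by omega)
        omega
      · rcases Nat.lt_succ_iff_lt_or_eq.1 hv with h | rfl
        · rw [← colour_mod c _ v (rk_lt h hcv), hmod, hjf v h hcv]
        · rw [colour, Nat.add_mul_div_left _ _ (by positivity), Nat.div_eq_of_lt hj, zero_add,
            Nat.mod_eq_of_lt hval, ZMod.natCast_zmod_val]

/-! ### From relations on `ℕ` to edge sets on `Fin n` -/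

section Bridge

variable {n : ℕ} {a c : ℕ → ℕ} {A C : Finset (Fin n)} {E : ℕ → ℕ → Prop}
  {X : Finset (Sym2 (Fin n))}

theorem count_eq_card (p : ℕ → Prop) [DecidablePred p] (n : ℕ) :
    Nat.count p n = (Finset.univ.filter fun v : Fin n => p v).card := by
  rw [Nat.count_eq_card_filter_range]
  symm
  refine Finset.card_bij (fun v _ => (v : ℕ)) (fun v hv => ?_) (fun v _ w _ h => Fin.ext h)
    fun x hx => ?_
  · simpa using hv
  · simp only [Finset.mem_filter, Finset.mem_range] at hx
    exact ⟨⟨x, hx.1⟩, by simpa using hx.2, rfl⟩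

theorem rk_eq_card (hc : ∀ v : Fin n, c v ≠ 0 ↔ v ∈ C) : rk c n = C.card := by
  rw [rk, count_eq_card]
  congr 1
  ext v
  simp [← hc v]

theorem degN_eq_degree (hE : ∀ u v : Fin n, E u v ↔ s(u, v) ∈ X) (v : Fin n) :
    degN n E v = degree X v := by
  classical
  rw [degN, count_eq_card, degree]
  congr 1
  ext u
  simp [hE]

theorem respects_iff_mono (hE : ∀ u v : Fin n, E u v ↔ s(u, v) ∈ X) (f : ℕ → ZMod 2) :
    Respects n E f ↔ Mono X fun v : Fin n => f v :=
  ⟨fun h u v huv => h u u.2 v v.2 ((hE u v).2 huv),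
    fun h u hu v hv huv => h ⟨u, hu⟩ ⟨v, hv⟩ ((hE ⟨u, hu⟩ ⟨v, hv⟩).1 huv)⟩

/-- Extend a function on `Fin n` by zero. -/
def extendZero (f : Fin n → ZMod 2) (x : ℕ) : ZMod 2 := if h : x < n then f ⟨x, h⟩ else 0

@[simp] theorem extendZero_val (f : Fin n → ZMod 2) (v : Fin n) : extendZero f v = f v := by
  simp [extendZero]

theorem valid_iff_degree (ha : ∀ v : Fin n, a v ≠ 0 ↔ v ∈ A) (hc : ∀ v : Fin n, c v ≠ 0 ↔ v ∈ C)
    (hE : ∀ u v : Fin n, E u v ↔ s(u, v) ∈ X) :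
    Valid n a c E ↔ ∀ v, (v ∈ C → degree X v ≤ 2) ∧ (v ∉ C → v ∈ A → degree X v = 2 ∧
      ∃ u ∈ C, ∀ f, Mono X f → f u = f v) := by
  have key : ∀ v : Fin n, (∃ u < n, c u ≠ 0 ∧ ∀ f, Respects n E f → f u = f v) ↔
      ∃ u ∈ C, ∀ f, Mono X f → f u = f v := by
    intro v
    constructor
    · rintro ⟨u, hu, hcu, h⟩
      refine ⟨⟨u, hu⟩, (hc ⟨u, hu⟩).1 hcu, fun f hf => ?_⟩
      have := h (extendZero f) ((respects_iff_mono hE _).2 (by simpa using hf))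
      rwa [extendZero_val, extendZero_val f ⟨u, hu⟩] at this
    · rintro ⟨u, hu, h⟩
      exact ⟨u, u.2, (hc u).2 hu, fun f hf => h _ ((respects_iff_mono hE f).1 hf)⟩
  constructor
  · intro h v
    have := h v v.2
    rw [degN_eq_degree hE, key, hc v, ha v] at this
    refine ⟨this.1, fun hvC => this.2 ?_⟩
    by_contra h0
    exact hvC ((hc v).1 h0)
  · intro h v hv
    have := h ⟨v, hv⟩
    rw [← key, ← degN_eq_degree hE, ← hc, ← ha] at this
    exact ⟨this.1, fun h0 => this.2 (not_not.2 h0)⟩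

theorem cutVec_eq_extension (hc : ∀ v : Fin n, c v ≠ 0 ↔ v ∈ C)
    (hE : ∀ u v : Fin n, E u v ↔ s(u, v) ∈ X) (j : Fin (2 ^ rk c n)) :
    cutVec n c E j =
      extension C (fun (j : Fin (2 ^ rk c n)) v => ((colour c j v : ℕ) : ZMod 2)) X j := by
  have key : (∃ f, Respects n E f ∧ ∀ v < n, c v ≠ 0 → f v = (colour c j v : ℕ)) ↔
      ∃ f, Mono X f ∧ ∀ v ∈ C, f v = ((colour c j v : ℕ) : ZMod 2) := by
    constructor
    · rintro ⟨f, hf, h⟩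
      exact ⟨_, (respects_iff_mono hE f).1 hf, fun v hv => h v v.2 ((hc v).2 hv)⟩
    · rintro ⟨f, hf, h⟩
      refine ⟨extendZero f, (respects_iff_mono hE _).2 (by simpa using hf), fun v hv hcv => ?_⟩
      rw [extendZero_val f ⟨v, hv⟩]
      exact h ⟨v, hv⟩ ((hc ⟨v, hv⟩).1 hcv)
  unfold cutVec extension
  by_cases h : ∃ f, Mono X f ∧ ∀ v ∈ C, f v = ((colour c j v : ℕ) : ZMod 2)
  · rw [if_pos (key.2 h), if_pos h]
  · rw [if_neg fun h' => h (key.1 h'), if_neg h]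

theorem existsUnique_colour (hc : ∀ v : Fin n, c v ≠ 0 ↔ v ∈ C) (f : Fin n → ZMod 2) :
    ∃! j : Fin (2 ^ rk c n), ∀ v ∈ C, f v = ((colour c j v : ℕ) : ZMod 2) := by
  obtain ⟨j, hj, h⟩ := exists_colour_eq c (extendZero f) n
  refine ⟨⟨j, hj⟩, fun v hv => ?_, fun j' h' => Fin.ext ?_⟩
  · rw [← h v v.2 ((hc v).2 hv), extendZero_val]
  · have := mod_eq_of_colour_eq (c := c) (j := j') (j' := j) n fun v hv hcv => by
      have h1 := h v hv hcv
      rw [extendZero_val f ⟨v, hv⟩, h' ⟨v, hv⟩ ((hc ⟨v, hv⟩).1 hcv),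
        ZMod.natCast_eq_natCast_iff'] at h1
      simpa [colour] using h1
    rwa [Nat.mod_eq_of_lt j'.2, Nat.mod_eq_of_lt hj] at this

/-- Pairing with `b` is linear: if it vanished on `s`, it would vanish on the span. -/
theorem exists_ne_zero_of_mem_span {ι : Type*} [Fintype ι] {s : Set (ι → ZMod 2)}
    {x b : ι → ZMod 2} (hx : x ∈ Submodule.span (ZMod 2) s) (h : ∑ j, x j * b j ≠ 0) :
    ∃ y ∈ s, ∑ j, y j * b j ≠ 0 := by
  by_contra! hcon
  apply h
  clear h
  induction hx using Submodule.span_induction with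
  | mem y hy => exact hcon y hy
  | zero => simp
  | add y z _ _ hy hz => simp [add_mul, Finset.sum_add_distrib, hy, hz]
  | smul r y _ hy => simp [mul_assoc, ← Finset.mul_sum, hy]

/-- Edge sets in the list `O` of representatives can replace all others. -/
theorem Represents.exists_hamiltonian {m : ℕ} {W : ℕ → ℕ} {O : List ℕ} {G : SimpleGraph (Fin n)}
    (hO : Represents n a c W m O) (ha : ∀ v : Fin n, a v ≠ 0 ↔ v ∈ A)
    (hc : ∀ v : Fin n, c v ≠ 0 ↔ v ∈ C) (hC : 3 ≤ C.card) {F : ℕ → Finset (Sym2 (Fin n))}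
    (hF : ∀ k < m, ∀ u v : Fin n, EdgeAt W n (k * (n * n)) u v ↔ s(u, v) ∈ F k)
    (hFG : ∀ k < m, (F k : Set (Sym2 (Fin n))) ⊆ inducedEdges G ((A : Set (Fin n)) ∪ C))
    {Y : Finset (Sym2 (Fin n))}
    (hY : (Y : Set (Sym2 (Fin n))) ⊆ inducedEdges G ((C : Set (Fin n)) ∪ (A : Set (Fin n))ᶜ))
    {k : ℕ} (hk : k < m) (h : Disjoint (F k) Y ∧ IsHamiltonianEdgeSet G (F k ∪ Y)) :
    ∃ l ∈ O, Disjoint (F l) Y ∧ IsHamiltonianEdgeSet G (F l ∪ Y) := by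
  have hn : 3 ≤ Fintype.card (Fin n) := hC.trans (Finset.card_le_univ C)
  obtain ⟨v₀, hv₀⟩ : C.Nonempty := Finset.card_pos.1 (by omega)
  have hFA : ∀ k < m, ∀ u v, s(u, v) ∈ F k → u ∈ A ∪ C := fun k hk u v huv => by
    simpa using (hFG k hk huv).2 u (by simp)
  have hYA : ∀ u v, s(u, v) ∈ Y → u ∈ A → u ∈ C := fun u v huv hu => by
    have := (hY huv).2 u (by simp)
    simp only [Set.mem_union, Finset.mem_coe, Set.mem_compl_iff] at this
    tauto
  have hFE : ∀ k < m, (F k : Set (Sym2 (Fin n))) ⊆ G.edgeSet := fun k hk e he => (hFG k hk he).1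
  have hYE : (Y : Set (Sym2 (Fin n))) ⊆ G.edgeSet := fun e he => (hY he).1
  have hdY : ∀ v ∈ A, v ∉ C → degree Y v = 0 := fun v hv hvC => Finset.card_eq_zero.2 <|
    Finset.filter_eq_empty_iff.2 fun u _ huv => hvC (hYA v u huv hv)
  have hdF : ∀ k < m, ∀ v, v ∉ C → v ∉ A → degree (F k) v = 0 := fun k hk v hvC hvA =>
    Finset.card_eq_zero.2 <| Finset.filter_eq_empty_iff.2 fun u _ huv => by
      have := hFA k hk v u huv
      simp [hvC, hvA] at this
  obtain ⟨hdeg, hcol⟩ := (hamiltonian_iff hn (hFE k hk) hYE).1 h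
  have hval : Valid n a c (EdgeAt W n (k * (n * n))) := by
    rw [valid_iff_degree ha hc (hF k hk)]
    refine fun v => ⟨fun _ => by have := hdeg v; omega, fun hvC hvA => ⟨?_, ?_⟩⟩
    · have := hdeg v
      have := hdY v hvA hvC
      omega
    · exact exists_mem_separator hv₀ (hFA k hk) hYA hcol hvA
  -- The second factor does not involve `l`, so all valid sets are tested against the same vector.
  have hsum : ∀ l < m, Valid n a c (EdgeAt W n (l * (n * n))) →
      (∑ j, cutVec n c (EdgeAt W n (l * (n * n))) j * ((outer A C (fun (j : Fin (2 ^ rk c n)) v =>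
        ((colour c j v : ℕ) : ZMod 2)) v₀ Y j).card : ZMod 2) ≠ 0 ↔
      ∀ f, Mono (F l) f → Mono Y f → ∀ u v, f u = f v) := by
    intro l hl hv
    rw [valid_iff_degree ha hc (hF l hl)] at hv
    rw [← card_colourings_ne_zero_iff v₀, card_colourings_eq_sum hv₀
      (existsUnique_colour hc) (hFA l hl) hYA fun v hvA hvC => ((hv v).2 hvC hvA).2]
    simp only [cutVec_eq_extension hc (hF l hl)]
  obtain ⟨_, ⟨l, hlO, hkey, rfl⟩, hne⟩ := exists_ne_zero_of_mem_span (hO.mem k hk hval)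
    ((hsum k hk hval).2 hcol)
  have hl : l < m := by simpa using hO.sublist.subset hlO
  have hlv := hO.valid l hlO
  refine ⟨l, hlO, (hamiltonian_iff hn (hFE l hl) hYE).2 ⟨fun v => ?_, (hsum l hl hlv).1 hne⟩⟩
  have hdv := hdeg v
  -- The degrees agree on `C` by equality of keys, are 2 on `A \ C` by validity, and are 0
  -- elsewhere.
  by_cases hvC : v ∈ C
  · have := eq_of_key_eq n (fun v hv => (hlv v hv).1) (fun v hv => (hval v hv).1) hkey v v.2
      ((hc v).2 hvC)
    rw [degN_eq_degree (hF l hl), degN_eq_degree (hF k hk)] at this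
    omega
  · by_cases hvA : v ∈ A
    · rw [valid_iff_degree ha hc (hF l hl)] at hlv
      have := ((hlv v).2 hvC hvA).1
      have := hdY v hvA hvC
      omega
    · have := hdF l hl v hvC hvA
      have := hdF k hk v hvC hvA
      omega

/-- A cell number determines block, row and column, by uniqueness of quotient and remainder applied
twice. -/
theorem encodeFamily_apply {L : List (Finset (Sym2 (Fin n)))} {i : ℕ} (hi : i < L.length)
    (u v : Fin n) [Decidable (s(u, v) ∈ L[i])] :
    encodeFamily L (i * (n * n) + (u * n + v)) = if s(u, v) ∈ L[i] then 1 else 0 := by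
  unfold encodeFamily
  refine if_congr ⟨?_, fun h => ⟨⟨i, hi⟩, u, v, ?_, h⟩⟩ rfl rfl
  · rintro ⟨⟨i', hi'⟩, u', v', he, hm⟩
    have hlt : ∀ u v : Fin n, (u * n + v : ℕ) < n * n := fun u v => by
      have h1 : ((u : ℕ) + 1) * n ≤ n * n := Nat.mul_le_mul_right _ u.2
      have h2 := v.2
      rw [Nat.succ_mul] at h1
      omega
    rw [sq] at he
    obtain ⟨h1, rfl⟩ := pair_inj (f := i) (f' := i') (hlt u v) (hlt u' v')
      (by simp only at he; omega)
    obtain ⟨h2, h3⟩ := pair_inj (f := (u : ℕ)) (f' := u') v.2 v'.2 (by omega)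
    obtain rfl := Fin.ext h2
    obtain rfl := Fin.ext h3
    exact hm
  · simp only [sq, add_assoc]

end Bridge

/-! ### Bounds for time and size -/

theorem stepTime_le {n N : ℕ} (hn : 1 ≤ n) (hN : 1 ≤ N) : stepTime n N ≤ 138 * (n ^ 3 * N ^ 2) := by
  have h : ∀ i ≤ 3, ∀ j ≤ 2, n ^ i * N ^ j ≤ n ^ 3 * N ^ 2 := fun i hi j hj =>
    Nat.mul_le_mul (Nat.pow_le_pow_right hn hi) (Nat.pow_le_pow_right hN hj)
  have h00 := h 0 (by norm_num) 0 (by norm_num)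
  have h10 := h 1 (by norm_num) 0 (by norm_num)
  have h20 := h 2 (by norm_num) 0 (by norm_num)
  have h30 := h 3 (by norm_num) 0 (by norm_num)
  have h01 := h 0 (by norm_num) 1 (by norm_num)
  have h11 := h 1 (by norm_num) 1 (by norm_num)
  have h02 := h 0 (by norm_num) 2 (by norm_num)
  -- The coefficients add up to 138.
  have e : stepTime n N = 24 * (n ^ 0 * N ^ 0) + 41 * (n ^ 1 * N ^ 0) + 17 * (n ^ 2 * N ^ 0) +
      6 * (n ^ 3 * N ^ 0) + 23 * (n ^ 0 * N ^ 1) + 15 * (n ^ 1 * N ^ 1) +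
      12 * (n ^ 0 * N ^ 2) := by
    unfold stepTime; ring
  rw [e]
  omega

theorem totalTime_le {n m N : ℕ} (hn : 1 ≤ n) (hN : 1 ≤ N) :
    totalTime n m N ≤ 164 * (n ^ 3 * N ^ 2 * max m 1) := by
  have h1 := stepTime_le hn hN
  have h2 : n ≤ n ^ 3 * N ^ 2 := by
    calc n = n ^ 1 * 1 := by ring
      _ ≤ _ := Nat.mul_le_mul (Nat.pow_le_pow_right hn (by norm_num)) (Nat.one_le_pow _ _ hN)
  have h3 : N ≤ n ^ 3 * N ^ 2 := by
    calc N = 1 * N ^ 1 := by ring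
      _ ≤ _ := Nat.mul_le_mul (Nat.one_le_pow _ _ hn) (Nat.pow_le_pow_right hN (by norm_num))
  have h4 : m * (stepTime n N + 3) ≤ max m 1 * (141 * (n ^ 3 * N ^ 2)) :=
    Nat.mul_le_mul (le_max_left _ _) (by omega)
  have h5 : n ^ 3 * N ^ 2 ≤ n ^ 3 * N ^ 2 * max m 1 :=
    Nat.le_mul_of_pos_right _ (lt_of_lt_of_le one_pos (le_max_right m 1))
  have e : max m 1 * (141 * (n ^ 3 * N ^ 2)) = 141 * (n ^ 3 * N ^ 2 * max m 1) := by ring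
  unfold totalTime
  omega

/-- Ordered pairs map onto unordered ones, so there are at most n² of the latter. -/
theorem card_family_le {n : ℕ} (S : Finset (Finset (Sym2 (Fin n)))) : S.card ≤ 2 ^ (n * n) := by
  refine (Finset.card_le_univ S).trans ?_
  rw [Fintype.card_finset]
  refine Nat.pow_le_pow_right (by norm_num) ?_
  have := Fintype.card_le_of_surjective _ (Sym2.mk_surjective (α := Fin n))
  simpa using this

end Reduction

open Reduction RAM in
theorem mainTheorem4 :
    ∃ (P : RAM.Prog) (c k : ℕ),
      ∀ (n : ℕ) (G : SimpleGraph (Fin n)) (A C : Finset (Fin n))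
        (S : Finset (Finset (Sym2 (Fin n)))) (L : List (Finset (Sym2 (Fin n)))),
        Separates G (C : Set (Fin n)) (A : Set (Fin n)) ((A : Set (Fin n))ᶜ) →
        3 ≤ C.card →
        (∀ X ∈ S, (X : Set (Sym2 (Fin n))) ⊆ inducedEdges G ((A : Set (Fin n)) ∪ C)) →
        L.Nodup → L.toFinset = S →
        ∃ (σ : RAM.State) (t : ℕ) (S' : Finset (Finset (Sym2 (Fin n))))
          (L' : List (Finset (Sym2 (Fin n)))),
          RAM.Runs P (inputState G A C L) σ t ∧
          t ≤ c * n ^ k * (max S.card 1 * 12 ^ C.card) ∧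
          OutputIs σ L' ∧ L'.Nodup ∧ L'.toFinset = S' ∧
          S' ⊆ S ∧
          S'.card ≤ 6 ^ C.card ∧
          ∀ Y : Finset (Sym2 (Fin n)),
            (Y : Set (Sym2 (Fin n))) ⊆ inducedEdges G ((C : Set (Fin n)) ∪ (A : Set (Fin n))ᶜ) →
            (∃ X ∈ S, Disjoint X Y ∧ IsHamiltonianEdgeSet G (X ∪ Y)) →
            ∃ X' ∈ S', Disjoint X' Y ∧ IsHamiltonianEdgeSet G (X' ∪ Y) := by
  -- At most 164 n³ 4^|C| max(|S|, 1) operations, each of cost at most 147 n².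
  refine ⟨program, 147 * 164, 5, fun n G A C S L _ hC hS hL hLS => ?_⟩
  have hn : 3 ≤ n := hC.trans (by simpa using Finset.card_le_univ C)
  have hm : L.length = S.card := by rw [← hLS, List.toFinset_card_of_nodup hL]
  have hmle : L.length ≤ 2 ^ (n * n) := hm ▸ card_family_le S
  set σ := inputState G A C L with hσ
  have ha : ∀ v : Fin n, σ.arr 1 v ≠ 0 ↔ v ∈ A := fun v => by
    simp [hσ, inputState, ← Fin.ext_iff]
  have hc : ∀ v : Fin n, σ.arr 2 v ≠ 0 ↔ v ∈ C := fun v => by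
    simp [hσ, inputState, ← Fin.ext_iff]
  have hrk := rk_eq_card hc
  have hCn : C.card ≤ n := by simpa using Finset.card_le_univ C
  -- The products below are at most 2^(n² + 3n), by |S| ≤ 2^(n²), n ≤ 2^n and 3^|C| ≤ 4^n; the extra
  -- factor 2 allows for sums of two terms.
  set B := 2 ^ (n * n + 3 * n + 1) with hB
  have hnlt : n ≤ 2 ^ n := Nat.lt_two_pow_self.le
  have h3n : 3 ^ C.card ≤ 2 ^ (2 * n) := by
    rw [pow_mul]
    exact (Nat.pow_le_pow_left (by norm_num) _).trans (Nat.pow_le_pow_right (by norm_num) hCn)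
  have h2n : 2 ^ C.card ≤ 2 ^ n := Nat.pow_le_pow_right (by norm_num) hCn
  have hpow : ∀ x ≤ n * n + 3 * n, 2 ^ x * 2 ≤ B := fun x hx => by
    rw [← pow_succ]; exact Nat.pow_le_pow_right (by norm_num) (by omega)
  have hB1 : 1 + L.length * 2 ^ C.card ≤ B := by
    have h1 := Nat.mul_le_mul hmle h2n
    rw [← pow_add] at h1
    have := hpow (n * n + n) (by omega)
    have : 1 ≤ 2 ^ (n * n + n) := Nat.one_le_two_pow
    omega
  have hB2 : L.length * (n * n) ≤ B := by
    have h1 := Nat.mul_le_mul hmle (Nat.mul_le_mul hnlt hnlt)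
    rw [← pow_add, ← pow_add] at h1
    have := hpow (n * n + (n + n)) (by omega)
    omega
  have hB3 : n * 3 ^ C.card ≤ B := by
    have h1 := Nat.mul_le_mul hnlt h3n
    rw [← pow_add] at h1
    have := hpow (n + 2 * n) (by omega)
    omega
  have hB4 : 3 ^ C.card + 2 ^ C.card * 3 ^ C.card ≤ B := by
    have h1 := Nat.mul_le_mul h2n h3n
    rw [← pow_add] at h1
    have := hpow (n + 2 * n) (by omega)
    have : 2 ^ (2 * n) ≤ 2 ^ (n + 2 * n) := Nat.pow_le_pow_right (by norm_num) (by omega)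
    omega
  have hbdd : Bdd B σ := by
    have hone : 1 ≤ B := Nat.one_le_two_pow
    refine ⟨fun x => ?_, fun x i => ?_⟩
    · match x with
      | 0 =>
        have := hpow n (by omega)
        change n ≤ B
        omega
      | 1 =>
        change L.length ≤ B
        have := Nat.le_mul_of_pos_right L.length (show 0 < 2 ^ C.card by positivity)
        omega
      | _ + 2 => exact Nat.zero_le _
    · match x with
      | 0 => simp only [hσ, inputState]; split_ifs <;> omega
      | 1 => simp only [hσ, inputState]; split_ifs <;> omega
      | 2 => simp only [hσ, inputState]; split_ifs <;> omega
      | 3 =>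
        change encodeFamily L i ≤ B
        unfold encodeFamily
        split_ifs <;> omega
      | _ + 4 => exact Nat.zero_le _
  obtain ⟨τ, t, hrun, ht, -, O, hO, hH, hlen⟩ := program_spec (B := B) (n := n) (m := L.length)
    (a := σ.arr 1) (c := σ.arr 2) (W := encodeFamily L) (σ := σ) rfl rfl
    (fun x hx => by obtain ⟨y, rfl⟩ := Nat.exists_eq_add_of_le' hx; rfl) rfl rfl rfl
    (fun _ => rfl) (by rwa [hrk]) hB2 (by rwa [hrk]) (by rwa [hrk]) hbdd
  rw [hrk] at ht hlen
  have hOlt : ∀ k ∈ O, k < L.length := fun k hk => by simpa using hO.sublist.subset hk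
  -- The default value is never met, as all numbers in `O` are below the length of `L`.
  have hget : ∀ k (hk : k < L.length), L.getD k ∅ = L[k] := fun k hk => by simp [hk]
  have hF : ∀ k < L.length, ∀ u v : Fin n,
      EdgeAt (encodeFamily L) n (k * (n * n)) u v ↔ s(u, v) ∈ L.getD k ∅ := fun k hk u v => by
    rw [EdgeAt, encodeFamily_apply hk, hget k hk]
    simp
  have hmemS : ∀ k < L.length, L.getD k ∅ ∈ S := fun k hk => by
    rw [hget k hk, ← hLS, List.mem_toFinset]
    exact List.getElem_mem hk
  set L' := O.map fun k => L.getD k ∅ with hL'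
  have hL'nd : L'.Nodup := by
    refine List.Nodup.map_on (fun k hk l hl h => ?_) (hO.sublist.nodup List.nodup_range)
    rw [hget k (hOlt k hk), hget l (hOlt l hl)] at h
    exact (hL.getElem_inj_iff).1 h
  have hlen' : L'.length = O.length := List.length_map _
  refine ⟨τ, t, L'.toFinset, L', hrun, ?_, ⟨hH.1.trans hlen'.symm, ?_⟩, hL'nd, rfl, ?_, ?_, ?_⟩
  · have h1 := totalTime_le (n := n) (m := L.length) (N := 2 ^ C.card) (by omega)
      Nat.one_le_two_pow
    -- This is n² + 3n + 8 ≤ 3n², which uses n ≥ 3.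
    have h2 : unitCost B ≤ 147 * n ^ 2 := (unitCost_le_of_le_pow le_rfl).trans (by nlinarith)
    have h3 : (2 ^ C.card) ^ 2 ≤ 12 ^ C.card := by
      rw [← pow_mul, mul_comm, pow_mul]
      exact Nat.pow_le_pow_left (by norm_num) _
    calc t ≤ _ := ht
      _ ≤ 164 * (n ^ 3 * 12 ^ C.card * max L.length 1) * (147 * n ^ 2) := by
        refine Nat.mul_le_mul (h1.trans ?_) h2
        gcongr
      _ = _ := by rw [hm]; ring
  · intro j hj
    rw [hlen', sq] at hj
    have hnn : 0 < n * n := by positivity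
    have hn0 : 0 < n := by omega
    obtain ⟨q, r, hr, rfl⟩ : ∃ q r, r < n * n ∧ q * (n * n) + r = j :=
      ⟨j / (n * n), j % (n * n), Nat.mod_lt _ hnn, Nat.div_add_mod' j _⟩
    have hq : q < O.length := by
      by_contra hq
      have := Nat.mul_le_mul_right (n * n) (not_lt.1 hq)
      omega
    obtain ⟨u, v, rfl⟩ : ∃ u v : Fin n, (u * n + v : ℕ) = r :=
      ⟨⟨r / n, Nat.div_lt_of_lt_mul hr⟩, ⟨r % n, Nat.mod_lt _ hn0⟩, Nat.div_add_mod' r n⟩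
    have hOq := hOlt _ (List.getElem_mem hq)
    rw [hH.2 q hq _ hr, encodeFamily_apply hOq, encodeFamily_apply (by omega : q < L'.length)]
    simp only [hL', List.getElem_map, hget _ hOq]
  · intro X hX
    rw [List.mem_toFinset, hL', List.mem_map] at hX
    obtain ⟨k, hk, rfl⟩ := hX
    exact hmemS k (hOlt k hk)
  · rw [List.toFinset_card_of_nodup hL'nd, hlen']
    exact hlen
  · rintro Y hY ⟨X, hX, hXY⟩
    rw [← hLS, List.mem_toFinset, List.mem_iff_getElem] at hX
    obtain ⟨k, hk, rfl⟩ := hX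
    rw [← hget k hk] at hXY
    obtain ⟨l, hl, h⟩ := hO.exists_hamiltonian ha hc hC hF (fun k hk => hS _ (hmemS k hk)) hY hk hXY
    exact ⟨_, by rw [List.mem_toFinset, hL']; exact List.mem_map_of_mem hl, h⟩
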